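/- Let $\gamma$ be a smooth oriented non self-intersecting curve in $\mathbb C$, parametrised by an open interval and possibly unbounded, with support $\operatorname{supp}\gamma$ (the closure of its trace), and let $\omega$ be an $N\times N$ matrix weight whose moments $\omega_k=\int_\gamma x^k\omega(x)\frac{dx}{2\pi i}$ exist (absolutely) and satisfy $\det[\omega_{j+k}]_{j,k=0}^n\neq0$ for all $n\in\mathbb N=\{0,1,2,\dots\}$. Let $P_n^{\mathsf L},P_n^{\mathsf R}$ be the monic $N\times N$ matrix polynomials of degree $n$, and $C_n$ the nonsingular matrices, with $$\int_\gamma P^{\mathsf L}_n(z)\omega(z)z^k\tfrac{dz}{2\pi i}=\delta_{n,k}C_n^{-1},\qquad \int_\gamma z^k\omega(z)P^{\mathsf R}_n(z)\tfrac{dz}{2\pi i}=\delta_{n,k}C_n^{-1},\qquad 0\le k\le n .$$ Put $Q_n^{\mathsf L}(z)=\int_\gamma\frac{P_n^{\mathsf L}(t)}{t-z}\omega(t)\frac{dt}{2\pi i}$, $Q_n^{\mathsf R}(z)=\int_\gamma\omega(t)\frac{P_n^{\mathsf R}(t)}{t-z}\frac{dt}{2\pi i}$ and $$Y_n^{\mathsf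 L}=\begin{bmatrix}P_n^{\mathsf L}&Q_n^{\mathsf L}\\-C_{n-1}P_{n-1}^{\mathsf L}&-C_{n-1}Q_{n-1}^{\mathsf L}\end{bmatrix},\qquad Y_n^{\mathsf R}=\begin{bmatrix}P_n^{\mathsf R}&-P_{n-1}^{\mathsf R}C_{n-1}\\Q_n^{\mathsf R}&-Q_{n-1}^{\mathsf R}C_{n-1}\end{bmatrix},$$ where for $n=0$ one reads $C_{-1}P^{\mathsf L}_{-1}=P^{\mathsf R}_{-1}C_{-1}=0$ and $C_{-1}Q^{\mathsf L}_{-1}=Q^{\mathsf R}_{-1}C_{-1}=-I$. Let $\phi$ be a scalar polynomial with $\deg\phi\le2$, let $h^{\mathsf L},h^{\mathsf R}$ be entire $N\times N$ matrix functions, and let $D\subseteq\mathbb C$ be an open set on which $\omega$ is holomorphic (for instance a neighbourhood of $\gamma$ on which the weight is analytic, or the complement of a branch cut along $\gamma$) and satisfies the generalized matrix Pearson equation $$\phi\,\omega'=h^{\mathsf L}\omega+\omega h^{\mathsf R}.$$ Let $\omega=\omega^{\mathsf L}\omega^{\mathsf R}$ on $D$, where $\omega^{\mathsf L}$ is holomorphic,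 $\omega^{\mathsf L},\omega^{\mathsf R}$ are nonsingular, and $\phi(\omega^{\mathsf L})'=h^{\mathsf L}\omega^{\mathsf L}$. Put $Z_n^{\mathsf L}=Y_n^{\mathsf L}\operatorname{diag}(\omega^{\mathsf L},(\omega^{\mathsf R})^{-1})$, $Z_n^{\mathsf R}=\operatorname{diag}(\omega^{\mathsf R},(\omega^{\mathsf L})^{-1})Y_n^{\mathsf R}$, $$\widetilde M_n^{\mathsf L}=\phi\,(Z_n^{\mathsf L})'(Z_n^{\mathsf L})^{-1},\qquad \widetilde M_n^{\mathsf R}=\phi\,(Z_n^{\mathsf R})^{-1}(Z_n^{\mathsf R})',\qquad \mathcal N(F)=F'+\frac{F^2}{\phi}.$$ **(General weights.)** For every $n\in\mathbb N$, $Y_n^{\mathsf L}$ and $Y_n^{\mathsf R}$ are holomorphic with determinant $1$ off $\operatorname{supp}\gamma$, $\widetilde M_n^{\mathsf L}$ and $\widetilde M_n^{\mathsf R}$ are holomorphic on $D\setminus\operatorname{supp}\gamma$, and at every $z\in D\setminus\operatorname{supp}\gamma$ with $\phi(z)\ne0$ $$\phi (Y_n^{\mathsf L})''+(Y_n^{\mathsf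 L})'\operatorname{diag}(2h^{\mathsf L}+\phi'I,-2h^{\mathsf R}+\phi'I)+Y_n^{\mathsf L}\operatorname{diag}(\mathcal N(h^{\mathsf L}),\mathcal N(-h^{\mathsf R}))=\mathcal N(\widetilde M_n^{\mathsf L})Y_n^{\mathsf L},$$ $$\phi (Y_n^{\mathsf R})''+\operatorname{diag}(2h^{\mathsf R}+\phi'I,-2h^{\mathsf L}+\phi'I)(Y_n^{\mathsf R})'+\operatorname{diag}(\mathcal N(h^{\mathsf R}),\mathcal N(-h^{\mathsf L}))Y_n^{\mathsf R}=Y_n^{\mathsf R}\mathcal N(\widetilde M_n^{\mathsf R}).$$ In particular, with $\mathcal N(\cdot)_{ij}$ the $N\times N$ blocks, at these points $$\begin{aligned} \phi (P_n^{\mathsf L})''+(P_n^{\mathsf L})'(2h^{\mathsf L}+\phi'I)+P_n^{\mathsf L}\mathcal N(h^{\mathsf L})&=\mathcal N(\widetilde M_n^{\mathsf L})_{11}P_n^{\mathsf L}-\mathcal N(\widetilde M_n^{\mathsf L})_{12}C_{n-1}P_{n-1}^{\mathsf L},\\ \phi (Q_n^{\mathsf L})''+(Q_n^{\mathsf L})'(-2h^{\mathsf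 R}+\phi'I)+Q_n^{\mathsf L}\mathcal N(-h^{\mathsf R})&=\mathcal N(\widetilde M_n^{\mathsf L})_{11}Q_n^{\mathsf L}-\mathcal N(\widetilde M_n^{\mathsf L})_{12}C_{n-1}Q_{n-1}^{\mathsf L},\\ \phi (P_n^{\mathsf R})''+(2h^{\mathsf R}+\phi'I)(P_n^{\mathsf R})'+\mathcal N(h^{\mathsf R})P_n^{\mathsf R}&=P_n^{\mathsf R}\mathcal N(\widetilde M_n^{\mathsf R})_{11}-P_{n-1}^{\mathsf R}C_{n-1}\mathcal N(\widetilde M_n^{\mathsf R})_{21},\\ \phi (Q_n^{\mathsf R})''+(-2h^{\mathsf L}+\phi'I)(Q_n^{\mathsf R})'+\mathcal N(-h^{\mathsf L})Q_n^{\mathsf R}&=Q_n^{\mathsf R}\mathcal N(\widetilde M_n^{\mathsf R})_{11}-Q_{n-1}^{\mathsf R}C_{n-1}\mathcal N(\widetilde M_n^{\mathsf R})_{21}. \end{aligned}$$ **(Examples.)** Below, $n\in\mathbb N$ is arbitrary, a scalar sequence $(p_n)$ is called monic orthogonal for $w$ on an interval if $p_n$ is monic of degree $n$ and $\int p_np_mw\frac{dt}{2\pi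 i}$ vanishes exactly when $n\ne m$; its second kind functions are $q_n(z)=\int\frac{p_n(t)}{t-z}w(t)\frac{dt}{2\pi i}$. Equations for polynomials hold on $\mathbb C$; the second kind functions are holomorphic off the closed interval, and their equations hold there. For scalar weights $w^1,w^2$ with monic orthogonal polynomials $p_n^1,p_n^2$ on the same interval put $$\mathbb P_n=\tfrac12\begin{bmatrix}p_n^1+p_n^2&p_n^1-p_n^2\\p_n^1-p_n^2&p_n^1+p_n^2\end{bmatrix},\quad \mathbb W=\tfrac12\begin{bmatrix}w^1+w^2&w^1-w^2\\w^1-w^2&w^1+w^2\end{bmatrix},\quad \mathbb Q_n(z)=\int\frac{\mathbb P_n(t)}{t-z}\mathbb W(t)\frac{dt}{2\pi i}.$$ 1. Hermite: $w=e^{-x^2}$ on $\mathbb R$, $\gamma_n=n/2$. Then $xH_n=H_{n+1}+\gamma_nH_{n-1}$, $H_n''-2zH_n'=-4\gamma_nH_n$ and $Q_n''+2zQ_n'=-(4\gamma_n+2)Q_n$. 2. Laguerre: $w^\alpha=x^\alpha e^{-x}$ on $(0,\infty)$, $\alpha>-1$. Then $z(L_n^\alpha)''-(z-\alpha-1)(L_n^\alpha)'=-nL_n^\alpha$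 and $z(Q_n^\alpha)''+(z-\alpha+1)(Q_n^\alpha)'=-(n+1)Q_n^\alpha$. 3. Berezanskii–Laguerre: $w^1=w^\alpha$, $w^2=w^\beta$ on $(0,\infty)$, $\alpha,\beta>-1$. Then $(\mathbb P_n)$ is both the left and the right monic orthogonal sequence for $\mathbb W$, $z\mathbb P_n''-\mathbb P_n'\Psi_1=-n\mathbb P_n$ and $z\mathbb Q_n''+\mathbb Q_n'\Psi_2=-(n+1)\mathbb Q_n$, where $$\Psi_1=\tfrac12\begin{bmatrix}-\alpha-\beta+2(z-1)&\beta-\alpha\\\beta-\alpha&-\alpha-\beta+2(z-1)\end{bmatrix},\quad\Psi_2=\tfrac12\begin{bmatrix}-\alpha-\beta+2(z+1)&\beta-\alpha\\\beta-\alpha&-\alpha-\beta+2(z+1)\end{bmatrix}.$$ 4. Jacobi: $W^{\alpha,\beta}=x^\alpha(1-x)^\beta$ on $(0,1)$, $\alpha,\beta>-1$. Then $z(1-z)p_n''+(1+\alpha-(\alpha+\beta+2)z)p_n'+n(\alpha+\beta+n+1)p_n=0$ and $z(1-z)q_n''+(1-\alpha+(\alpha+\beta-2)z)q_n'+(n+1)(\alpha+\beta+n)q_n=0$.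 5. Berezanskii–Jacobi: $w^1=W^{\alpha,\beta}$, $w^2=W^{\beta,\alpha}$ on $(0,1)$, $\alpha,\beta>-1$. Then $(\mathbb P_n)$ is both the left and the right monic orthogonal sequence for $\mathbb W$, $z(1-z)\mathbb P_n''+\mathbb P_n'\Psi_1+n(\alpha+\beta+n+1)\mathbb P_n=0$ and $z(1-z)\mathbb Q_n''+\mathbb Q_n'\Psi_2+(n+1)(\alpha+\beta+n)\mathbb Q_n=0$, where $$\Psi_1=\tfrac12\begin{bmatrix}(1-2z)(\alpha+\beta+2)&\alpha-\beta\\\alpha-\beta&(1-2z)(\alpha+\beta+2)\end{bmatrix},\quad\Psi_2=\tfrac12\begin{bmatrix}(2z-1)(\alpha+\beta-2)&\beta-\alpha\\\beta-\alpha&(2z-1)(\alpha+\beta-2)\end{bmatrix}.$$ -/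

import Mathlib

open Polynomial MeasureTheory

noncomputable section

namespace RHMatrix

/-! ### Curves and integration along them -/

/-- A smooth, oriented, non self-intersecting curve in the plane, possibly unbounded,
parametrised by an open interval. (End points, if any, play no role for integrals.) -/
structure SmoothArc where
  dom : Set ℝ
  toFun : ℝ → ℂ
  isOpen_dom : IsOpen dom
  ordConnected_dom : dom.OrdConnected
  nonempty_dom : dom.Nonempty
  smooth : ContDiffOn ℝ (⊤ : ℕ∞) toFun dom
  deriv_ne_zero : ∀ t ∈ dom, deriv toFun t ≠ 0
  injOn : Set.InjOn toFun dom

/-- The support of the curve: the closure of its trace. -/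
def SmoothArc.support (γ : SmoothArc) : Set ℂ := closure (γ.toFun '' γ.dom)

/-- Absolute integrability of a scalar function along the curve. -/
def SmoothArc.IntegrableAlong (γ : SmoothArc) (f : ℂ → ℂ) : Prop :=
  IntegrableOn (fun t : ℝ => deriv γ.toFun t * f (γ.toFun t)) γ.dom

/-- `∫_γ f(x) dx / (2πi)`. -/
def SmoothArc.integral (γ : SmoothArc) (f : ℂ → ℂ) : ℂ :=
  (2 * (Real.pi : ℂ) * Complex.I)⁻¹ * ∫ t in γ.dom, deriv γ.toFun t * f (γ.toFun t)

/-- `∫_γ F(x) dx / (2πi)` for matrix functions, entrywise. -/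
def SmoothArc.matIntegral {m n : Type*} (γ : SmoothArc) (F : ℂ → Matrix m n ℂ) : Matrix m n ℂ :=
  Matrix.of fun i j => γ.integral fun x => F x i j

/-- An open real interval, oriented from left to right. -/
def SmoothArc.ofInterval (I : Set ℝ) (ho : IsOpen I) (hc : I.OrdConnected) (hn : I.Nonempty) :
    SmoothArc where
  dom := I
  toFun := fun t => (t : ℂ)
  isOpen_dom := ho
  ordConnected_dom := hc
  nonempty_dom := hn
  smooth := Complex.ofRealCLM.contDiff.contDiffOn
  deriv_ne_zero := fun t _ => by
    have h : HasDerivAt (fun t : ℝ => (t : ℂ)) 1 t := Complex.ofRealCLM.hasDerivAt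
    rw [h.deriv]; exact one_ne_zero
  injOn := Complex.ofReal_injective.injOn

/-- The real line. -/
def realLine : SmoothArc :=
  .ofInterval Set.univ isOpen_univ Set.ordConnected_univ Set.univ_nonempty

/-- The half line `(0, ∞)`. -/
def halfLine : SmoothArc :=
  .ofInterval (Set.Ioi 0) isOpen_Ioi Set.ordConnected_Ioi ⟨1, by simp⟩

/-- The interval `(0, 1)`. -/
def unitSegment : SmoothArc :=
  .ofInterval (Set.Ioo 0 1) isOpen_Ioo Set.ordConnected_Ioo
    (Set.nonempty_Ioo.2 zero_lt_one)

/-! ### Calculus of matrix functions of a complex variable, entrywise -/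

/-- Entrywise derivative. -/
def mderiv {m n : Type*} (F : ℂ → Matrix m n ℂ) (z : ℂ) : Matrix m n ℂ :=
  Matrix.of fun i j => deriv (fun w => F w i j) z

/-- Every entry is holomorphic on (the open set) `U`. -/
def HolomorphicOn {m n : Type*} (F : ℂ → Matrix m n ℂ) (U : Set ℂ) : Prop :=
  ∀ i j, DifferentiableOn ℂ (fun z => F z i j) U

/-- `𝒩(F) = F' + F² / φ`. -/
def opN {m : Type*} [Fintype m] (φ : ℂ[X]) (F : ℂ → Matrix m m ℂ) (z : ℂ) : Matrix m m ℂ :=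
  mderiv F z + (φ.eval z)⁻¹ • (F z * F z)

/-- The value at the scalar `z` of a polynomial with matrix coefficients. -/
def evalAt {N : ℕ} (P : (Matrix (Fin N) (Fin N) ℂ)[X]) (z : ℂ) : Matrix (Fin N) (Fin N) ℂ :=
  P.eval (Matrix.scalar (Fin N) z)

/-! ### Regular matrix weights, biorthogonal polynomials, second kind functions -/

section Weights

variable {N : ℕ} (γ : SmoothArc) (ω : ℂ → Matrix (Fin N) (Fin N) ℂ)

/-- The moment of order `n`. -/
def moment (n : ℕ) : Matrix (Fin N) (Fin N) ℂ :=
  γ.matIntegral fun x => x ^ n • ω x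

/-- The block Hankel matrix of moments with blocks `ω_{j+k}`, `0 ≤ j, k ≤ n`. -/
def momentMatrix (n : ℕ) : Matrix (Fin (n + 1) × Fin N) (Fin (n + 1) × Fin N) ℂ :=
  Matrix.of fun p q => moment γ ω (p.1 + q.1) p.2 q.2

/-- The weight is regular: all moments exist and all moment matrices are nonsingular. -/
structure IsRegular : Prop where
  integrable : ∀ (n : ℕ) (i j : Fin N), γ.IntegrableAlong fun x => x ^ n * ω x i j
  det_ne_zero : ∀ n : ℕ, (momentMatrix γ ω n).det ≠ 0

/-- The `n`-th term is monic of degree `n`. -/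
def IsMonicSequence (P : ℕ → (Matrix (Fin N) (Fin N) ℂ)[X]) : Prop :=
  ∀ n, (P n).natDegree ≤ n ∧ (P n).coeff n = 1

/-- Left orthogonality: `∫ P_n ω z^k dz/(2πi) = δ_{n,k} C_n⁻¹`, `0 ≤ k ≤ n`, `C_n` nonsingular. -/
structure IsLeftOrthogonal (P : ℕ → (Matrix (Fin N) (Fin N) ℂ)[X])
    (C : ℕ → Matrix (Fin N) (Fin N) ℂ) : Prop where
  monic : IsMonicSequence P
  nonsingular : ∀ n, (C n).det ≠ 0
  orthogonal : ∀ n k : ℕ, k ≤ n →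
    γ.matIntegral (fun z => z ^ k • (evalAt (P n) z * ω z)) = if n = k then (C n)⁻¹ else 0

/-- Right orthogonality: `∫ z^k ω P_n dz/(2πi) = δ_{n,k} C_n⁻¹`, `0 ≤ k ≤ n`, `C_n` nonsingular. -/
structure IsRightOrthogonal (P : ℕ → (Matrix (Fin N) (Fin N) ℂ)[X])
    (C : ℕ → Matrix (Fin N) (Fin N) ℂ) : Prop where
  monic : IsMonicSequence P
  nonsingular : ∀ n, (C n).det ≠ 0
  orthogonal : ∀ n k : ℕ, k ≤ n →
    γ.matIntegral (fun z => z ^ k • (ω z * evalAt (P n) z)) = if n = k then (C n)⁻¹ else 0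

/-- `Q_n^L(z) = ∫ P_n^L(t) ω(t) / (t - z) dt/(2πi)`. -/
def secondKindL (P : ℕ → (Matrix (Fin N) (Fin N) ℂ)[X]) (n : ℕ) (z : ℂ) :
    Matrix (Fin N) (Fin N) ℂ :=
  γ.matIntegral fun t => (t - z)⁻¹ • (evalAt (P n) t * ω t)

/-- `Q_n^R(z) = ∫ ω(t) P_n^R(t) / (t - z) dt/(2πi)`. -/
def secondKindR (P : ℕ → (Matrix (Fin N) (Fin N) ℂ)[X]) (n : ℕ) (z : ℂ) :
    Matrix (Fin N) (Fin N) ℂ :=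
  γ.matIntegral fun t => (t - z)⁻¹ • (ω t * evalAt (P n) t)

variable (P : ℕ → (Matrix (Fin N) (Fin N) ℂ)[X]) (C : ℕ → Matrix (Fin N) (Fin N) ℂ)

/-- `C_{n-1} P_{n-1}^L`, with `P_{-1}^L = 0`. -/
def prevPL : ℕ → ℂ → Matrix (Fin N) (Fin N) ℂ
  | 0, _ => 0
  | n + 1, z => C n * evalAt (P n) z

/-- `C_{n-1} Q_{n-1}^L`, with `Q_{-1}^L = - C_{-1}⁻¹`. -/
def prevQL : ℕ → ℂ → Matrix (Fin N) (Fin N) ℂ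
  | 0, _ => -1
  | n + 1, z => C n * secondKindL γ ω P n z

/-- `P_{n-1}^R C_{n-1}`, with `P_{-1}^R = 0`. -/
def prevPR : ℕ → ℂ → Matrix (Fin N) (Fin N) ℂ
  | 0, _ => 0
  | n + 1, z => evalAt (P n) z * C n

/-- `Q_{n-1}^R C_{n-1}`, with `Q_{-1}^R = - C_{-1}⁻¹`. -/
def prevQR : ℕ → ℂ → Matrix (Fin N) (Fin N) ℂ
  | 0, _ => -1
  | n + 1, z => secondKindR γ ω P n z * C n

/-- `Y_n^L`, with rows `(P_n, Q_n)` and `(-C_{n-1} P_{n-1}, -C_{n-1} Q_{n-1})`. -/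
def YL (n : ℕ) (z : ℂ) : Matrix (Fin N ⊕ Fin N) (Fin N ⊕ Fin N) ℂ :=
  Matrix.fromBlocks (evalAt (P n) z) (secondKindL γ ω P n z)
    (-prevPL P C n z) (-prevQL γ ω P C n z)

/-- `Y_n^R`, with rows `(P_n, -P_{n-1} C_{n-1})` and `(Q_n, -Q_{n-1} C_{n-1})`. -/
def YR (n : ℕ) (z : ℂ) : Matrix (Fin N ⊕ Fin N) (Fin N ⊕ Fin N) ℂ :=
  Matrix.fromBlocks (evalAt (P n) z) (-prevPR P C n z)
    (secondKindR γ ω P n z) (-prevQR γ ω P C n z)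

end Weights

/-! ### Pearson equations and structure matrices -/

section Pearson

variable {N : ℕ}

/-- On the open set `D` the weight satisfies `φ ω' = h^L ω + ω h^R`, where `deg φ ≤ 2` and
`h^L`, `h^R` are entire, and `ω = ω^L ω^R` is a factorization with nonsingular factors such that
`φ (ω^L)' = h^L ω^L`. -/
structure PearsonFactorization (φ : ℂ[X]) (hL hR : ℂ → Matrix (Fin N) (Fin N) ℂ) (D : Set ℂ)
    (ω ωL ωR : ℂ → Matrix (Fin N) (Fin N) ℂ) : Prop where
  degree_le : φ.natDegree ≤ 2
  entireL : HolomorphicOn hL Set.univ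
  entireR : HolomorphicOn hR Set.univ
  isOpen : IsOpen D
  holomorphic : HolomorphicOn ω D
  pearson : ∀ z ∈ D, φ.eval z • mderiv ω z = hL z * ω z + ω z * hR z
  holomorphicL : HolomorphicOn ωL D
  pearsonL : ∀ z ∈ D, φ.eval z • mderiv ωL z = hL z * ωL z
  factor : ∀ z ∈ D, ω z = ωL z * ωR z
  nonsingularL : ∀ z ∈ D, (ωL z).det ≠ 0
  nonsingularR : ∀ z ∈ D, (ωR z).det ≠ 0

variable (φ : ℂ[X]) (ωL ωR : ℂ → Matrix (Fin N) (Fin N) ℂ)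
  (Y : ℂ → Matrix (Fin N ⊕ Fin N) (Fin N ⊕ Fin N) ℂ)

/-- `Z^L = Y^L diag(ω^L, (ω^R)⁻¹)`. -/
def ZL (z : ℂ) : Matrix (Fin N ⊕ Fin N) (Fin N ⊕ Fin N) ℂ :=
  Y z * Matrix.fromBlocks (ωL z) 0 0 (ωR z)⁻¹

/-- `Z^R = diag(ω^R, (ω^L)⁻¹) Y^R`. -/
def ZR (z : ℂ) : Matrix (Fin N ⊕ Fin N) (Fin N ⊕ Fin N) ℂ :=
  Matrix.fromBlocks (ωR z) 0 0 (ωL z)⁻¹ * Y z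

/-- `φ M^L`, where `M^L = (Z^L)' (Z^L)⁻¹`. -/
def structL (z : ℂ) : Matrix (Fin N ⊕ Fin N) (Fin N ⊕ Fin N) ℂ :=
  φ.eval z • (mderiv (ZL ωL ωR Y) z * (ZL ωL ωR Y z)⁻¹)

/-- `φ M^R`, where `M^R = (Z^R)⁻¹ (Z^R)'`. -/
def structR (z : ℂ) : Matrix (Fin N ⊕ Fin N) (Fin N ⊕ Fin N) ℂ :=
  φ.eval z • ((ZR ωL ωR Y z)⁻¹ * mderiv (ZR ωL ωR Y) z)

end Pearson

/-! ### Scalar orthogonal polynomials and the Berezanskii construction -/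

/-- `p` is the sequence of monic orthogonal polynomials for the scalar weight `w` on `γ`. -/
structure IsMonicOrthogonal (γ : SmoothArc) (w : ℂ → ℂ) (p : ℕ → ℂ[X]) : Prop where
  monic : ∀ n, (p n).Monic
  natDegree_eq : ∀ n, (p n).natDegree = n
  orthogonal : ∀ n m, n ≠ m → γ.integral (fun t => (p n).eval t * w t * (p m).eval t) = 0
  norm_ne_zero : ∀ n, γ.integral (fun t => (p n).eval t * w t * (p n).eval t) ≠ 0

/-- Second kind function of the polynomial `p` for the scalar weight `w`. -/
def secondKind (γ : SmoothArc) (w : ℂ → ℂ) (p : ℂ[X]) (z : ℂ) : ℂ :=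
  γ.integral fun t => p.eval t / (t - z) * w t

/-- The matrix `½ [[a + b, a - b], [a - b, a + b]]`. -/
def berezanskii {R : Type*} [Ring R] [Module ℂ R] (a b : R) : Matrix (Fin 2) (Fin 2) R :=
  (2⁻¹ : ℂ) • !![a + b, a - b; a - b, a + b]

/-- The Berezanskii polynomials, as polynomials with matrix coefficients. -/
def berezanskiiPoly (p₁ p₂ : ℕ → ℂ[X]) (n : ℕ) : (Matrix (Fin 2) (Fin 2) ℂ)[X] :=
  matPolyEquiv (berezanskii (p₁ n) (p₂ n))

/-- The Berezanskii weight. -/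
def berezanskiiWeight (w₁ w₂ : ℂ → ℂ) (z : ℂ) : Matrix (Fin 2) (Fin 2) ℂ :=
  berezanskii (w₁ z) (w₂ z)

/-- `e^{-x²}`. -/
def hermiteWeight (z : ℂ) : ℂ := Complex.exp (-z ^ 2)

/-- `x^α e^{-x}`. -/
def laguerreWeight (α : ℝ) (z : ℂ) : ℂ := z ^ (α : ℂ) * Complex.exp (-z)

/-- `x^α (1 - x)^β`. -/
def jacobiWeight (α β : ℝ) (z : ℂ) : ℂ := z ^ (α : ℂ) * (1 - z) ^ (β : ℂ)

end RHMatrix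

end

/-! General weights. Put `G = diag(ω^L, (ω^R)⁻¹)` and `H = diag(h^L, -h^R)`, so that `φ G' = H G`.
Then `Z = Y G` turns the definition of the structure matrix into the first order relation `φ Y' + Y
H = M Y`. Differentiating it once and removing the remaining `M Y'` with the relation itself gives
the second order equation (`second_order_left`); the right one follows by transposition. What is
needed about `Y` is holomorphy off the support and determinant one. No Riemann–Hilbert argument
(jumps, behaviour at infinity, Liouville) is used. Splitting off divided differences,
biorthogonality evaluates `Q_n^L P_m^R - P_n^L Q_m^R` for neighbouring indices (`secondKind_cross`).
These values say that an explicit rearrangement of `Y_n^R` inverts `Y_n^L`, and that consecutive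
`Y_n^L` differ by a transfer matrix of determinant one, so `det Y_n^L = 1` by induction.

Examples. All weights satisfy `(A w)' = (d + e x) w` with `A = a + b x + c x²` and no boundary
terms. This makes `q ↦ A q'' + (d + e x) q'` symmetric for the moment functional; as it does not
raise degrees, each orthogonal polynomial is an eigenvector (`hypOp_eq_of_orthogonal`). Testing the
same weak identity against powers of the resolvent `(t - z)⁻¹` shows that the second kind functions
satisfy the adjoint equation (`IsClassicalWeight.secondKind_equation`). The Berezanskii matrices are
one fixed conjugation of `diag(a, b)`, so they multiply, add and integrate componentwise. The two
scalar problems share `A`, `e` and hence the eigenvalues; only `d` differs and becomes the matrix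
coefficient. -/

noncomputable section

namespace RHMatrix

/-! ### Entrywise calculus -/

section Calculus

variable {l m n : Type*}

/-- Every entry is differentiable at `z`. -/
def DiffAt (F : ℂ → Matrix m n ℂ) (z : ℂ) : Prop :=
  ∀ i j, DifferentiableAt ℂ (fun w => F w i j) z

theorem HolomorphicOn.diffAt {F : ℂ → Matrix m n ℂ} {U : Set ℂ} (hF : HolomorphicOn F U)
    (hU : IsOpen U) {z : ℂ} (hz : z ∈ U) : DiffAt F z :=
  fun i j => (hF i j).differentiableAt (hU.mem_nhds hz)

theorem HolomorphicOn.mono {F : ℂ → Matrix m n ℂ} {U V : Set ℂ} (hF : HolomorphicOn F U)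
    (h : V ⊆ U) : HolomorphicOn F V :=
  fun i j => (hF i j).mono h

theorem HolomorphicOn.congr {F G : ℂ → Matrix m n ℂ} {U : Set ℂ} (hF : HolomorphicOn F U)
    (h : ∀ z ∈ U, G z = F z) : HolomorphicOn G U :=
  fun i j => (hF i j).congr fun z hz => by simp only [h z hz]

theorem HolomorphicOn.mul [Fintype m] {F : ℂ → Matrix l m ℂ} {G : ℂ → Matrix m n ℂ} {U : Set ℂ}
    (hF : HolomorphicOn F U) (hG : HolomorphicOn G U) :
    HolomorphicOn (fun z => F z * G z) U := fun i j => by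
  simp only [Matrix.mul_apply]
  exact DifferentiableOn.fun_sum fun k _ => (hF i k).mul (hG k j)

theorem HolomorphicOn.smul {c : ℂ → ℂ} {F : ℂ → Matrix m n ℂ} {U : Set ℂ}
    (hc : DifferentiableOn ℂ c U) (hF : HolomorphicOn F U) :
    HolomorphicOn (fun z => c z • F z) U :=
  fun i j => hc.mul (hF i j)

theorem HolomorphicOn.neg {F : ℂ → Matrix m n ℂ} {U : Set ℂ}
    (hF : HolomorphicOn F U) : HolomorphicOn (fun z => -F z) U :=
  fun i j => (hF i j).neg

theorem HolomorphicOn.transpose {F : ℂ → Matrix m n ℂ} {U : Set ℂ}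
    (hF : HolomorphicOn F U) : HolomorphicOn (fun z => (F z).transpose) U :=
  fun i j => hF j i

theorem holomorphicOn_const (A : Matrix m n ℂ) (U : Set ℂ) : HolomorphicOn (fun _ => A) U :=
  fun _ _ => differentiableOn_const _

theorem HolomorphicOn.mderiv {F : ℂ → Matrix m n ℂ} {U : Set ℂ} (hF : HolomorphicOn F U)
    (hU : IsOpen U) : HolomorphicOn (mderiv F) U :=
  fun i j => (hF i j).deriv hU

theorem HolomorphicOn.fromBlocks {m' n' : Type*} {A : ℂ → Matrix m n ℂ} {B : ℂ → Matrix m n' ℂ}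
    {C : ℂ → Matrix m' n ℂ} {D : ℂ → Matrix m' n' ℂ} {U : Set ℂ} (hA : HolomorphicOn A U)
    (hB : HolomorphicOn B U) (hC : HolomorphicOn C U) (hD : HolomorphicOn D U) :
    HolomorphicOn (fun z => Matrix.fromBlocks (A z) (B z) (C z) (D z)) U := by
  rintro (i | i) (j | j)
  exacts [hA i j, hB i j, hC i j, hD i j]

theorem mderiv_fromBlocks {m' n' : Type*} (A : ℂ → Matrix m n ℂ) (B : ℂ → Matrix m n' ℂ)
    (C : ℂ → Matrix m' n ℂ) (D : ℂ → Matrix m' n' ℂ) :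
    mderiv (fun z => Matrix.fromBlocks (A z) (B z) (C z) (D z)) =
      fun z => Matrix.fromBlocks (mderiv A z) (mderiv B z) (mderiv C z) (mderiv D z) := by
  funext z
  ext (i | i) (j | j) <;> rfl

theorem mderiv_const (A : Matrix m n ℂ) (z : ℂ) : mderiv (fun _ => A) z = 0 := by
  ext i j; simp [mderiv]

theorem mderiv_add {F G : ℂ → Matrix m n ℂ} {z : ℂ} (hF : DiffAt F z) (hG : DiffAt G z) :
    mderiv (fun w => F w + G w) z = mderiv F z + mderiv G z := by
  ext i j
  exact deriv_fun_add (hF i j) (hG i j)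

theorem mderiv_smul {c : ℂ → ℂ} {F : ℂ → Matrix m n ℂ} {z : ℂ} (hc : DifferentiableAt ℂ c z)
    (hF : DiffAt F z) :
    mderiv (fun w => c w • F w) z = deriv c z • F z + c z • mderiv F z := by
  ext i j
  exact deriv_fun_mul hc (hF i j)

theorem mderiv_mul [Fintype m] {F : ℂ → Matrix l m ℂ} {G : ℂ → Matrix m n ℂ} {z : ℂ}
    (hF : DiffAt F z) (hG : DiffAt G z) :
    mderiv (fun w => F w * G w) z = mderiv F z * G z + F z * mderiv G z := by
  ext i j
  simp only [mderiv, Matrix.of_apply, Matrix.mul_apply, Matrix.add_apply]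
  rw [deriv_fun_sum fun k _ => (hF i k).fun_mul (hG k j), ← Finset.sum_add_distrib]
  exact Finset.sum_congr rfl fun k _ => deriv_fun_mul (hF i k) (hG k j)

theorem mderiv_congr {F G : ℂ → Matrix m n ℂ} {U : Set ℂ} (hU : IsOpen U)
    (h : ∀ z ∈ U, F z = G z) {z : ℂ} (hz : z ∈ U) : mderiv F z = mderiv G z := by
  ext i j
  refine Filter.EventuallyEq.deriv_eq ?_
  filter_upwards [hU.mem_nhds hz] with w hw
  simp only [h w hw]

variable [Fintype m] [DecidableEq m]

theorem HolomorphicOn.det {F : ℂ → Matrix m m ℂ} {U : Set ℂ} (hF : HolomorphicOn F U) :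
    DifferentiableOn ℂ (fun z => (F z).det) U := by
  simp only [Matrix.det_apply]
  exact DifferentiableOn.fun_sum fun σ _ =>
    (DifferentiableOn.fun_finsetProd fun i _ => hF (σ i) i).const_smul _

/-- Cramer's rule: the inverse is the adjugate over the determinant, and each adjugate entry is the
determinant of `F` with one row replaced by a constant vector. -/
theorem HolomorphicOn.inv {F : ℂ → Matrix m m ℂ} {U : Set ℂ} (hF : HolomorphicOn F U)
    (h : ∀ z ∈ U, (F z).det ≠ 0) : HolomorphicOn (fun z => (F z)⁻¹) U := by
  have hadj : HolomorphicOn (fun z => (F z).adjugate) U := fun i j => by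
    simp only [Matrix.adjugate_apply]
    refine HolomorphicOn.det fun a b => ?_
    by_cases hab : a = j
    · subst hab
      simp
    · simpa [Matrix.updateRow_ne hab] using hF a b
  refine (HolomorphicOn.smul (hF.det.inv h) hadj).congr fun z _ => ?_
  rw [Matrix.inv_def, Ring.inverse_eq_inv']
  rfl

theorem mderiv_inv {F : ℂ → Matrix m m ℂ} {U : Set ℂ} (hU : IsOpen U) (hF : HolomorphicOn F U)
    (h : ∀ z ∈ U, (F z).det ≠ 0) {z : ℂ} (hz : z ∈ U) :
    mderiv (fun w => (F w)⁻¹) z = -((F z)⁻¹ * mderiv F z * (F z)⁻¹) := by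
  have hu : ∀ w ∈ U, IsUnit (F w).det := fun w hw => (h w hw).isUnit
  have key := mderiv_mul (hF.diffAt hU hz) ((hF.inv h).diffAt hU hz)
  rw [mderiv_congr hU (fun w hw => Matrix.mul_nonsing_inv _ (hu w hw)) hz, mderiv_const] at key
  have h2 : F z * mderiv (fun w => (F w)⁻¹) z = -(mderiv F z * (F z)⁻¹) :=
    (neg_eq_of_add_eq_zero_right key.symm).symm
  have h3 := congrArg (fun A => (F z)⁻¹ * A) h2
  simpa [← mul_assoc, Matrix.nonsing_inv_mul _ (hu z hz)] using h3

/-! ### Second order equations from first order ones -/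

variable {U : Set ℂ} (φ : ℂ[X]) {Y G H M : ℂ → Matrix m m ℂ}

/-- Differentiating `h` produces `M Y'`. The relation gives `φ M Y' = M² Y - (M Y) H`, and replacing
`M Y` by `φ Y' + Y H` yields `M Y' = φ⁻¹ M² Y - Y' H - φ⁻¹ Y H²`. The term `-Y' H` doubles the one
from the product rule, whence `2 H`; the squares complete `H'` and `M'` to `𝒩(H)` and `𝒩(M)`. Since
`φ` is scalar it commutes with everything. -/
theorem second_order_left (hU : IsOpen U) (hY : HolomorphicOn Y U) (hH : HolomorphicOn H U)
    (hM : HolomorphicOn M U)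
    (h : ∀ z ∈ U, φ.eval z • mderiv Y z + Y z * H z = M z * Y z) {z : ℂ} (hz : z ∈ U)
    (hφ : φ.eval z ≠ 0) :
    φ.eval z • mderiv (mderiv Y) z + mderiv Y z * ((2 : ℂ) • H z + φ.derivative.eval z • 1)
      + Y z * opN φ H z = opN φ M z * Y z := by
  have hY' := hY.mderiv hU
  have hφd : DifferentiableOn ℂ (fun w => φ.eval w) U := φ.differentiable.differentiableOn
  have key := mderiv_congr hU h hz
  rw [mderiv_add ((HolomorphicOn.smul hφd hY').diffAt hU hz) ((hY.mul hH).diffAt hU hz),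
    mderiv_smul φ.differentiableAt (hY'.diffAt hU hz),
    mderiv_mul (hY.diffAt hU hz) (hH.diffAt hU hz),
    mderiv_mul (hM.diffAt hU hz) (hY.diffAt hU hz), Polynomial.deriv] at key
  have h0 := h z hz
  have h1 : M z * mderiv Y z = (φ.eval z)⁻¹ • (M z * M z * Y z)
      - mderiv Y z * H z - (φ.eval z)⁻¹ • (Y z * (H z * H z)) := by
    have e1 : mderiv Y z = (φ.eval z)⁻¹ • (M z * Y z - Y z * H z) := by
      rw [← h0, add_sub_cancel_right, smul_smul, inv_mul_cancel₀ hφ, one_smul]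
    have e2 : M z * mderiv Y z = (φ.eval z)⁻¹ • (M z * M z * Y z - M z * Y z * H z) := by
      conv_lhs => rw [e1]
      rw [Matrix.mul_smul, mul_sub, ← mul_assoc, ← mul_assoc]
    rw [e2, ← h0, add_mul, Matrix.smul_mul, smul_sub, smul_add, smul_smul, inv_mul_cancel₀ hφ,
      one_smul, mul_assoc (Y z)]
    have e3 : φ.eval z • mderiv Y z = M z * Y z - Y z * H z := by rw [← h0]; abel
    abel
  rw [h1] at key
  simp only [opN, mul_add, add_mul, Matrix.smul_mul, Matrix.mul_smul, mul_one, two_smul]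
  rw [← sub_eq_zero] at key ⊢
  rw [← key]
  abel

theorem second_order_right (hU : IsOpen U) (hY : HolomorphicOn Y U) (hH : HolomorphicOn H U)
    (hM : HolomorphicOn M U)
    (h : ∀ z ∈ U, φ.eval z • mderiv Y z + H z * Y z = Y z * M z) {z : ℂ} (hz : z ∈ U)
    (hφ : φ.eval z ≠ 0) :
    φ.eval z • mderiv (mderiv Y) z + ((2 : ℂ) • H z + φ.derivative.eval z • 1) * mderiv Y z
      + opN φ H z * Y z = Y z * opN φ M z := by
  have key := second_order_left φ hU hY.transpose hH.transpose hM.transpose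
    (fun z hz => by
      have := congrArg Matrix.transpose (h z hz)
      rw [Matrix.transpose_add, Matrix.transpose_mul, Matrix.transpose_mul] at this
      exact this) hz hφ
  have := congrArg Matrix.transpose key
  have hN : ∀ F : ℂ → Matrix m m ℂ,
      (opN φ (fun w => (F w).transpose) z).transpose = opN φ F z := fun F => by
    simp only [opN, Matrix.transpose_add, Matrix.transpose_smul, Matrix.transpose_mul,
      Matrix.transpose_transpose]
    rfl
  have hD : ∀ F : ℂ → Matrix m m ℂ,
      mderiv (fun w => (F w).transpose) = fun w => (mderiv F w).transpose := fun F => rfl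
  simpa only [hD, Matrix.transpose_add, Matrix.transpose_smul, Matrix.transpose_mul,
    Matrix.transpose_transpose, Matrix.transpose_one, hN] using this

/-- By the product rule `φ (Y G)' = (φ Y' + Y H) G`, so `G` cancels in `φ (Y G)' (Y G)⁻¹`.
Holomorphy of `M` comes from its definition, as `Y G` is invertible on `U`. -/
theorem first_order_left (hU : IsOpen U) (hY : HolomorphicOn Y U) (hG : HolomorphicOn G U)
    (hYd : ∀ z ∈ U, (Y z).det ≠ 0) (hGd : ∀ z ∈ U, (G z).det ≠ 0)
    (hGH : ∀ z ∈ U, φ.eval z • mderiv G z = H z * G z)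
    (hMdef : M = fun z => φ.eval z • (mderiv (fun w => Y w * G w) z * (Y z * G z)⁻¹)) :
    HolomorphicOn M U ∧ ∀ z ∈ U, φ.eval z • mderiv Y z + Y z * H z = M z * Y z := by
  have hd : ∀ z ∈ U, (Y z * G z).det ≠ 0 := fun z hz => by
    rw [Matrix.det_mul]; exact mul_ne_zero (hYd z hz) (hGd z hz)
  subst hMdef
  refine ⟨HolomorphicOn.smul φ.differentiable.differentiableOn
    (((hY.mul hG).mderiv hU).mul ((hY.mul hG).inv hd)), fun z hz => ?_⟩
  have hGu : IsUnit (G z).det := (hGd z hz).isUnit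
  have hYu : IsUnit (Y z).det := (hYd z hz).isUnit
  beta_reduce
  have e : φ.eval z • (mderiv Y z * G z + Y z * mderiv G z)
      = (φ.eval z • mderiv Y z + Y z * H z) * G z := by
    rw [smul_add, ← Matrix.smul_mul, ← Matrix.mul_smul, hGH z hz, add_mul, mul_assoc (Y z)]
  rw [mderiv_mul (hY.diffAt hU hz) (hG.diffAt hU hz), Matrix.mul_inv_rev, ← Matrix.smul_mul, e,
    mul_assoc (_ + _), ← mul_assoc (G z), Matrix.mul_nonsing_inv _ hGu, one_mul, mul_assoc,
    Matrix.nonsing_inv_mul _ hYu, mul_one]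

theorem first_order_right (hU : IsOpen U) (hY : HolomorphicOn Y U) (hG : HolomorphicOn G U)
    (hYd : ∀ z ∈ U, (Y z).det ≠ 0) (hGd : ∀ z ∈ U, (G z).det ≠ 0)
    (hGH : ∀ z ∈ U, φ.eval z • mderiv G z = G z * H z)
    (hMdef : M = fun z => φ.eval z • ((G z * Y z)⁻¹ * mderiv (fun w => G w * Y w) z)) :
    HolomorphicOn M U ∧ ∀ z ∈ U, φ.eval z • mderiv Y z + H z * Y z = Y z * M z := by
  have hd : ∀ z ∈ U, (G z * Y z).det ≠ 0 := fun z hz => by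
    rw [Matrix.det_mul]; exact mul_ne_zero (hGd z hz) (hYd z hz)
  subst hMdef
  refine ⟨HolomorphicOn.smul φ.differentiable.differentiableOn
    (((hG.mul hY).inv hd).mul ((hG.mul hY).mderiv hU)), fun z hz => ?_⟩
  have hGu : IsUnit (G z).det := (hGd z hz).isUnit
  have hYu : IsUnit (Y z).det := (hYd z hz).isUnit
  beta_reduce
  have e : φ.eval z • (mderiv G z * Y z + G z * mderiv Y z)
      = G z * (φ.eval z • mderiv Y z + H z * Y z) := by
    rw [smul_add, ← Matrix.smul_mul, ← Matrix.mul_smul, hGH z hz, mul_add, mul_assoc (G z),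
      add_comm]
  rw [mderiv_mul (hG.diffAt hU hz) (hY.diffAt hU hz), Matrix.mul_inv_rev, ← Matrix.mul_smul, e,
    mul_assoc (Y z)⁻¹, ← mul_assoc (G z)⁻¹, Matrix.nonsing_inv_mul _ hGu, one_mul, ← mul_assoc,
    Matrix.mul_nonsing_inv _ hYu, one_mul]

end Calculus

/-! ### Integration along curves -/

namespace SmoothArc

variable (γ : SmoothArc)

theorem measurableSet_dom : MeasurableSet γ.dom := γ.isOpen_dom.measurableSet

theorem isOpen_compl_support : IsOpen γ.supportᶜ := isClosed_closure.isOpen_compl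

theorem mem_support {t : ℝ} (ht : t ∈ γ.dom) : γ.toFun t ∈ γ.support :=
  subset_closure ⟨t, ht, rfl⟩

theorem sub_ne_zero {z : ℂ} (hz : z ∈ γ.supportᶜ) {t : ℝ} (ht : t ∈ γ.dom) :
    γ.toFun t - z ≠ 0 :=
  _root_.sub_ne_zero.2 fun h => hz (h ▸ γ.mem_support ht)

/-- Near a point off the support, the distance to the curve is bounded below. -/
theorem exists_norm_inv_le {z : ℂ} (hz : z ∈ γ.supportᶜ) :
    ∃ δ > 0, Metric.ball z δ ⊆ γ.supportᶜ ∧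
      ∀ w ∈ Metric.ball z δ, ∀ t ∈ γ.dom, ‖(γ.toFun t - w)⁻¹‖ ≤ δ⁻¹ := by
  obtain ⟨ε, hε, hb⟩ := Metric.isOpen_iff.1 γ.isOpen_compl_support z hz
  -- Halving the radius leaves every point of the smaller ball at distance at least `ε / 2` from the
  -- curve, uniformly.
  refine ⟨ε / 2, half_pos hε, (Metric.ball_subset_ball (by linarith)).trans hb,
    fun w hw t ht => ?_⟩
  have h1 : ε ≤ dist (γ.toFun t) z := by
    by_contra h
    exact hb (Metric.mem_ball.2 (not_le.1 h)) (γ.mem_support ht)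
  have h2 := Metric.mem_ball.1 hw
  have h3 := dist_triangle (γ.toFun t) w z
  rw [norm_inv, ← dist_eq_norm]
  exact inv_anti₀ (half_pos hε) (by linarith)

variable {γ}

theorem IntegrableAlong.const_mul {f : ℂ → ℂ} (hf : γ.IntegrableAlong f) (c : ℂ) :
    γ.IntegrableAlong fun t => c * f t :=
  (Integrable.const_mul hf c).congr (Filter.Eventually.of_forall fun t => by ring)

theorem IntegrableAlong.add {f g : ℂ → ℂ} (hf : γ.IntegrableAlong f) (hg : γ.IntegrableAlong g) :
    γ.IntegrableAlong fun t => f t + g t :=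
  (Integrable.add hf hg).congr (Filter.Eventually.of_forall fun t => by
    simp only [Pi.add_apply]; ring)

theorem IntegrableAlong.sum {ι : Type*} (s : Finset ι) {f : ι → ℂ → ℂ}
    (hf : ∀ i ∈ s, γ.IntegrableAlong (f i)) : γ.IntegrableAlong fun t => ∑ i ∈ s, f i t :=
  (integrable_finsetSum s hf).congr (Filter.Eventually.of_forall fun t => by
    simp only [Finset.mul_sum])

theorem IntegrableAlong.congr {f g : ℂ → ℂ} (hf : γ.IntegrableAlong f)
    (h : ∀ t ∈ γ.dom, f (γ.toFun t) = g (γ.toFun t)) : γ.IntegrableAlong g :=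
  IntegrableOn.congr_fun hf (fun t ht => by simp only [h t ht]) γ.measurableSet_dom

theorem integral_const_mul (c : ℂ) (f : ℂ → ℂ) :
    γ.integral (fun t => c * f t) = c * γ.integral f := by
  simp only [integral, mul_left_comm _ c]
  rw [MeasureTheory.integral_const_mul]
  ring

theorem integral_add {f g : ℂ → ℂ} (hf : γ.IntegrableAlong f) (hg : γ.IntegrableAlong g) :
    γ.integral (fun t => f t + g t) = γ.integral f + γ.integral g := by
  simp only [integral, mul_add]
  rw [MeasureTheory.integral_add hf hg, mul_add]

theorem integral_sum {ι : Type*} (s : Finset ι) {f : ι → ℂ → ℂ}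
    (hf : ∀ i ∈ s, γ.IntegrableAlong (f i)) :
    γ.integral (fun t => ∑ i ∈ s, f i t) = ∑ i ∈ s, γ.integral (f i) := by
  simp only [integral, Finset.mul_sum]
  rw [MeasureTheory.integral_finsetSum s hf, Finset.mul_sum]

theorem integral_congr {f g : ℂ → ℂ} (h : ∀ t ∈ γ.dom, f (γ.toFun t) = g (γ.toFun t)) :
    γ.integral f = γ.integral g := by
  unfold integral
  rw [setIntegral_congr_fun (g := fun t => deriv γ.toFun t * g (γ.toFun t)) γ.measurableSet_dom
    fun t ht => by simp only [h t ht]]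

theorem aestronglyMeasurable_resolvent {z : ℂ} (hz : z ∈ γ.supportᶜ) (k : ℕ) :
    AEStronglyMeasurable (fun t => (γ.toFun t - z)⁻¹ ^ k) (volume.restrict γ.dom) :=
  (((γ.smooth.continuousOn.sub continuousOn_const).inv₀
    fun _ ht => γ.sub_ne_zero hz ht).pow k).aestronglyMeasurable γ.measurableSet_dom

theorem IntegrableAlong.resolvent {f : ℂ → ℂ} (hf : γ.IntegrableAlong f) {z : ℂ}
    (hz : z ∈ γ.supportᶜ) (k : ℕ) : γ.IntegrableAlong fun t => (t - z)⁻¹ ^ k * f t := by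
  obtain ⟨δ, hδ, -, hb⟩ := γ.exists_norm_inv_le hz
  have := Integrable.bdd_mul (c := δ⁻¹ ^ k) hf (aestronglyMeasurable_resolvent hz k)
    (ae_restrict_of_forall_mem γ.measurableSet_dom fun t ht => by
      rw [norm_pow]
      exact pow_le_pow_left₀ (norm_nonneg _) (hb z (Metric.mem_ball_self hδ) t ht) k)
  exact this.congr (Filter.Eventually.of_forall fun t => by ring)

/-- Differentiation under the integral sign: on a small ball the differentiated kernel is bounded by
`k δ⁻¹ ^ (k + 1)`, so a multiple of `|f|` dominates. A general power `k` lets the lemma be iterated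
to obtain second derivatives. -/
theorem hasDerivAt_cauchy {f : ℂ → ℂ} (hf : γ.IntegrableAlong f) {z : ℂ}
    (hz : z ∈ γ.supportᶜ) (k : ℕ) :
    HasDerivAt (fun w => γ.integral fun t => (t - w)⁻¹ ^ k * f t)
      (γ.integral fun t => k * (t - z)⁻¹ ^ (k + 1) * f t) z := by
  obtain ⟨δ, hδ, hsub, hb⟩ := γ.exists_norm_inv_le hz
  have hnhds := Metric.ball_mem_nhds z hδ
  refine (hasDerivAt_integral_of_dominated_loc_of_deriv_le
    (F := fun w t => deriv γ.toFun t * ((γ.toFun t - w)⁻¹ ^ k * f (γ.toFun t)))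
    (F' := fun w t => deriv γ.toFun t * (k * (γ.toFun t - w)⁻¹ ^ (k + 1) * f (γ.toFun t)))
    (bound := fun t => (k * δ⁻¹ ^ (k + 1)) * ‖deriv γ.toFun t * f (γ.toFun t)‖)
    hnhds ?_ (hf.resolvent hz k) ?_ ?_ (hf.norm.const_mul _) ?_).2.const_mul _
  · filter_upwards [hnhds] with w hw
    exact (hf.resolvent (hsub hw) k).aestronglyMeasurable
  · exact (((hf.resolvent hz (k + 1)).const_mul k).congr
      (g := fun t => k * (t - z)⁻¹ ^ (k + 1) * f t) fun t _ => by
      rw [mul_assoc]).aestronglyMeasurable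
  · refine ae_restrict_of_forall_mem γ.measurableSet_dom fun t ht w hw => ?_
    rw [show deriv γ.toFun t * (k * (γ.toFun t - w)⁻¹ ^ (k + 1) * f (γ.toFun t)) =
      (k * (γ.toFun t - w)⁻¹ ^ (k + 1)) * (deriv γ.toFun t * f (γ.toFun t)) by ring, norm_mul]
    refine mul_le_mul_of_nonneg_right ?_ (norm_nonneg _)
    rw [norm_mul, norm_pow, Complex.norm_natCast]
    exact mul_le_mul_of_nonneg_left
      (pow_le_pow_left₀ (norm_nonneg _) (hb w hw t ht) _) (Nat.cast_nonneg _)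
  · refine ae_restrict_of_forall_mem γ.measurableSet_dom fun t ht w hw => ?_
    have hne := γ.sub_ne_zero (hsub hw) ht
    have h1 : HasDerivAt (fun w : ℂ => (γ.toFun t - w)⁻¹) ((γ.toFun t - w)⁻¹ ^ 2) w := by
      refine (((hasDerivAt_id w).const_sub (γ.toFun t)).inv hne).congr_deriv ?_
      simp
    refine (((h1.fun_pow k).mul_const (f (γ.toFun t))).const_mul (deriv γ.toFun t)).congr_deriv ?_
    -- The power rule carries the truncated exponent `k - 1`, so `k = 0` is treated apart.
    rcases k with _ | k
    · simp
    · rw [Nat.add_sub_cancel]; ring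

end SmoothArc

section MatIntegral

variable {l m n : Type*} {γ : SmoothArc}

/-- Entrywise absolute integrability along the curve. -/
def MatIntegrable (γ : SmoothArc) (F : ℂ → Matrix m n ℂ) : Prop :=
  ∀ i j, γ.IntegrableAlong fun t => F t i j

theorem MatIntegrable.const_smul {F : ℂ → Matrix m n ℂ} (hF : MatIntegrable γ F) (c : ℂ) :
    MatIntegrable γ fun t => c • F t :=
  fun i j => (hF i j).const_mul c

theorem MatIntegrable.resolvent {F : ℂ → Matrix m n ℂ} (hF : MatIntegrable γ F) {z : ℂ}
    (hz : z ∈ γ.supportᶜ) : MatIntegrable γ fun t => (t - z)⁻¹ • F t := fun i j => by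
  simpa using (hF i j).resolvent hz 1

theorem MatIntegrable.const_mul [Fintype m] {F : ℂ → Matrix m n ℂ} (hF : MatIntegrable γ F)
    (A : Matrix l m ℂ) : MatIntegrable γ fun t => A * F t := fun i j => by
  simp only [Matrix.mul_apply]
  exact SmoothArc.IntegrableAlong.sum _ fun k _ => (hF k j).const_mul _

theorem MatIntegrable.mul_const [Fintype m] {F : ℂ → Matrix l m ℂ} (hF : MatIntegrable γ F)
    (A : Matrix m n ℂ) : MatIntegrable γ fun t => F t * A := fun i j => by
  simp only [Matrix.mul_apply, mul_comm _ (A _ _)]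
  exact SmoothArc.IntegrableAlong.sum _ fun k _ => (hF i k).const_mul _

theorem MatIntegrable.sum {ι : Type*} (s : Finset ι) {F : ι → ℂ → Matrix m n ℂ}
    (hF : ∀ i ∈ s, MatIntegrable γ (F i)) : MatIntegrable γ fun t => ∑ i ∈ s, F i t :=
  fun i j => by
    simp only [Matrix.sum_apply]
    exact SmoothArc.IntegrableAlong.sum _ fun k hk => hF k hk i j

theorem matIntegral_add {F G : ℂ → Matrix m n ℂ} (hF : MatIntegrable γ F)
    (hG : MatIntegrable γ G) :
    γ.matIntegral (fun t => F t + G t) = γ.matIntegral F + γ.matIntegral G := by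
  ext i j
  exact SmoothArc.integral_add (hF i j) (hG i j)

theorem matIntegral_const_smul (F : ℂ → Matrix m n ℂ) (c : ℂ) :
    γ.matIntegral (fun t => c • F t) = c • γ.matIntegral F := by
  ext i j
  exact SmoothArc.integral_const_mul c fun t => F t i j

theorem matIntegral_sub {F G : ℂ → Matrix m n ℂ} (hF : MatIntegrable γ F)
    (hG : MatIntegrable γ G) :
    γ.matIntegral (fun t => F t - G t) = γ.matIntegral F - γ.matIntegral G := by
  have := matIntegral_add hF (hG.const_smul (-1))
  rw [matIntegral_const_smul] at this
  simpa [sub_eq_add_neg] using this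

theorem matIntegral_const_mul [Fintype m] {F : ℂ → Matrix m n ℂ} (hF : MatIntegrable γ F)
    (A : Matrix l m ℂ) : γ.matIntegral (fun t => A * F t) = A * γ.matIntegral F := by
  ext i j
  simp only [SmoothArc.matIntegral, Matrix.mul_apply, Matrix.of_apply]
  rw [SmoothArc.integral_sum _ fun k _ => (hF k j).const_mul _]
  exact Finset.sum_congr rfl fun k _ => SmoothArc.integral_const_mul _ _

theorem matIntegral_mul_const [Fintype m] {F : ℂ → Matrix l m ℂ} (hF : MatIntegrable γ F)
    (A : Matrix m n ℂ) : γ.matIntegral (fun t => F t * A) = γ.matIntegral F * A := by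
  ext i j
  simp only [SmoothArc.matIntegral, Matrix.mul_apply, Matrix.of_apply, mul_comm _ (A _ _)]
  rw [SmoothArc.integral_sum _ fun k _ => (hF i k).const_mul _]
  exact Finset.sum_congr rfl fun k _ => SmoothArc.integral_const_mul _ _

theorem matIntegral_sum {ι : Type*} (s : Finset ι) {F : ι → ℂ → Matrix m n ℂ}
    (hF : ∀ i ∈ s, MatIntegrable γ (F i)) :
    γ.matIntegral (fun t => ∑ i ∈ s, F i t) = ∑ i ∈ s, γ.matIntegral (F i) := by
  ext i j
  simp only [SmoothArc.matIntegral, Matrix.sum_apply, Matrix.of_apply]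
  exact SmoothArc.integral_sum _ fun k hk => hF k hk i j

theorem matIntegral_congr {F G : ℂ → Matrix m n ℂ}
    (h : ∀ t ∈ γ.dom, F (γ.toFun t) = G (γ.toFun t)) : γ.matIntegral F = γ.matIntegral G := by
  ext i j
  exact SmoothArc.integral_congr (f := fun t => F t i j) (g := fun t => G t i j)
    fun t ht => by simp only [h t ht]

theorem MatIntegrable.congr {F G : ℂ → Matrix m n ℂ} (hF : MatIntegrable γ F)
    (h : ∀ t ∈ γ.dom, F (γ.toFun t) = G (γ.toFun t)) : MatIntegrable γ G :=
  fun i j => (hF i j).congr fun t ht => by rw [h t ht]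

theorem MatIntegrable.holomorphicOn_cauchy {F : ℂ → Matrix m n ℂ} (hF : MatIntegrable γ F) :
    HolomorphicOn (fun z => γ.matIntegral fun t => (t - z)⁻¹ • F t) γ.supportᶜ :=
  fun i j z hz => by
    have := (SmoothArc.hasDerivAt_cauchy (hF i j) hz 1).differentiableAt.differentiableWithinAt
      (s := γ.supportᶜ)
    simp only [pow_one] at this
    exact this

end MatIntegral

/-! ### Matrix polynomials at scalars -/

section EvalAt

variable {N : ℕ}

theorem evalAt_eq_sum (P : (Matrix (Fin N) (Fin N) ℂ)[X]) {n : ℕ} (h : P.natDegree ≤ n) (z : ℂ) :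
    evalAt P z = ∑ k ∈ Finset.range (n + 1), z ^ k • P.coeff k := by
  rw [evalAt, eval_eq_sum_range' (Nat.lt_succ_of_le h)]
  refine Finset.sum_congr rfl fun k _ => ?_
  rw [← map_pow, Matrix.scalar_apply, ← Matrix.smul_eq_mul_diagonal]

theorem holomorphicOn_evalAt (P : (Matrix (Fin N) (Fin N) ℂ)[X]) (U : Set ℂ) :
    HolomorphicOn (evalAt P) U := fun i j => by
  have : (fun z => evalAt P z i j) =
      fun z => ∑ k ∈ Finset.range (P.natDegree + 1), z ^ k * P.coeff k i j := by
    funext z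
    rw [evalAt_eq_sum P le_rfl, Matrix.sum_apply]
    rfl
  rw [this]
  fun_prop

/-- Divided differences of polynomials with coefficients in a module. -/
theorem exists_divided_difference {E : Type*} [AddCommGroup E] [Module ℂ E] (n : ℕ) :
    ∀ A : ℕ → E, ∀ z : ℂ, ∃ B : ℕ → E, (∀ k, n = k + 1 → B k = A n) ∧
      ∀ t : ℂ, ∑ k ∈ Finset.range (n + 1), t ^ k • A k - ∑ k ∈ Finset.range (n + 1), z ^ k • A k
        = (t - z) • ∑ k ∈ Finset.range n, t ^ k • B k := by
  induction n with
  | zero => exact fun A z => ⟨0, fun k h => absurd h (Nat.succ_ne_zero k).symm, fun t => by simp⟩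
  | succ n ih =>
    intro A z
    obtain ⟨B, hB, h⟩ := ih (fun k => A (k + 1)) z
    -- Horner's scheme: with `p(t) = t p₁(t) + A 0`, one has `p(t) - p(z) = (t - z) p₁(z) + t (p₁(t)
    -- - p₁(z))`. The constant coefficient of the quotient is therefore `p₁(z)`, and the others are
    -- those of the quotient for `p₁`, shifted.
    obtain ⟨B', hB0, hBs⟩ : ∃ B' : ℕ → E,
        B' 0 = ∑ k ∈ Finset.range (n + 1), z ^ k • A (k + 1) ∧ ∀ k, B' (k + 1) = B k :=
      ⟨Nat.rec (motive := fun _ => E) _ fun k _ => B k, rfl, fun _ => rfl⟩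
    refine ⟨B', ?_, fun t => ?_⟩
    · rintro (_ | k) hk
      · obtain rfl : n = 0 := by omega
        simp [hB0]
      · rw [hBs, hB k (by omega)]
    · have e : ∀ s : ℂ, ∑ k ∈ Finset.range (n + 1 + 1), s ^ k • A k
          = s • (∑ k ∈ Finset.range (n + 1), s ^ k • A (k + 1)) + A 0 := fun s => by
        rw [Finset.sum_range_succ', Finset.smul_sum]
        simp only [smul_smul, pow_succ', pow_zero, one_smul]
      rw [e, e, sub_eq_iff_eq_add.1 (h t), Finset.sum_range_succ' (fun k => t ^ k • B' k) n]
      have e' : ∑ k ∈ Finset.range n, t ^ (k + 1) • B k =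
          t • ∑ k ∈ Finset.range n, t ^ k • B k := by
        rw [Finset.smul_sum]
        simp only [smul_smul, pow_succ']
      simp only [pow_zero, one_smul, hB0, hBs, e']
      module

end EvalAt

/-! ### Biorthogonality and the fundamental matrices -/

section Biorthogonal

variable {N : ℕ} {γ : SmoothArc} {ω : ℂ → Matrix (Fin N) (Fin N) ℂ}

theorem IsRegular.matIntegrable (h : IsRegular γ ω) (k : ℕ) :
    MatIntegrable γ fun t => t ^ k • ω t :=
  fun i j => h.integrable k i j

theorem IsRegular.matIntegrable_left (h : IsRegular γ ω) (P : (Matrix (Fin N) (Fin N) ℂ)[X])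
    (k : ℕ) : MatIntegrable γ fun t => t ^ k • (evalAt P t * ω t) := by
  have := MatIntegrable.sum (Finset.range (P.natDegree + 1)) fun i _ =>
    (h.matIntegrable (i + k)).const_mul (P.coeff i)
  refine this.congr fun t _ => ?_
  rw [evalAt_eq_sum P le_rfl, Finset.sum_mul, Finset.smul_sum]
  refine Finset.sum_congr rfl fun i _ => ?_
  rw [Matrix.mul_smul, Matrix.smul_mul, smul_smul, pow_add, mul_comm]

theorem IsRegular.matIntegrable_right (h : IsRegular γ ω) (P : (Matrix (Fin N) (Fin N) ℂ)[X])
    (k : ℕ) : MatIntegrable γ fun t => t ^ k • (ω t * evalAt P t) := by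
  have := MatIntegrable.sum (Finset.range (P.natDegree + 1)) fun i _ =>
    (h.matIntegrable (i + k)).mul_const (P.coeff i)
  refine this.congr fun t _ => ?_
  rw [evalAt_eq_sum P le_rfl, Finset.mul_sum, Finset.smul_sum]
  refine Finset.sum_congr rfl fun i _ => ?_
  rw [Matrix.mul_smul, Matrix.smul_mul, smul_smul, pow_add, mul_comm]

theorem IsRegular.holomorphicOn_secondKindL (h : IsRegular γ ω)
    (P : ℕ → (Matrix (Fin N) (Fin N) ℂ)[X]) (n : ℕ) :
    HolomorphicOn (secondKindL γ ω P n) γ.supportᶜ :=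
  MatIntegrable.holomorphicOn_cauchy (by simpa using h.matIntegrable_left (P n) 0)

theorem IsRegular.holomorphicOn_secondKindR (h : IsRegular γ ω)
    (P : ℕ → (Matrix (Fin N) (Fin N) ℂ)[X]) (n : ℕ) :
    HolomorphicOn (secondKindR γ ω P n) γ.supportᶜ :=
  MatIntegrable.holomorphicOn_cauchy (by simpa using h.matIntegrable_right (P n) 0)

variable {PL PR : ℕ → (Matrix (Fin N) (Fin N) ℂ)[X]} {C : ℕ → Matrix (Fin N) (Fin N) ℂ}

/-- The sum has degree below `m ≤ n + 1`, so orthogonality kills every power except possibly `t ^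
n`, which occurs only when `m = n + 1`. -/
theorem IsLeftOrthogonal.integral_mul_sum (hL : IsLeftOrthogonal γ ω PL C) (h : IsRegular γ ω)
    {n m : ℕ} (hm : m ≤ n + 1) (B : ℕ → Matrix (Fin N) (Fin N) ℂ) :
    MatIntegrable γ (fun t => evalAt (PL n) t * ω t * ∑ k ∈ Finset.range m, t ^ k • B k) ∧
    γ.matIntegral (fun t => evalAt (PL n) t * ω t * ∑ k ∈ Finset.range m, t ^ k • B k)
      = if m = n + 1 then (C n)⁻¹ * B n else 0 := by
  have hint : ∀ k ∈ Finset.range m,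
      MatIntegrable γ fun t => t ^ k • (evalAt (PL n) t * ω t) * B k :=
    fun k _ => (h.matIntegrable_left (PL n) k).mul_const (B k)
  have e : (fun t => evalAt (PL n) t * ω t * ∑ k ∈ Finset.range m, t ^ k • B k) =
      fun t => ∑ k ∈ Finset.range m, t ^ k • (evalAt (PL n) t * ω t) * B k := by
    funext t
    simp only [Finset.mul_sum, Matrix.mul_smul, Matrix.smul_mul]
  rw [e]
  refine ⟨MatIntegrable.sum _ hint, ?_⟩
  rw [matIntegral_sum _ hint]
  have : ∀ k ∈ Finset.range m, γ.matIntegral (fun t => t ^ k • (evalAt (PL n) t * ω t) * B k) =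
      if n = k then (C n)⁻¹ * B n else 0 := fun k hk => by
    rw [matIntegral_mul_const (h.matIntegrable_left (PL n) k),
      hL.orthogonal n k (by have := Finset.mem_range.1 hk; omega)]
    split_ifs with hnk
    · rw [hnk]
    · rw [zero_mul]
  rw [Finset.sum_congr rfl this, Finset.sum_ite_eq]
  simp only [Finset.mem_range]
  exact if_congr (by omega) rfl rfl

theorem IsRightOrthogonal.integral_sum_mul (hR : IsRightOrthogonal γ ω PR C) (h : IsRegular γ ω)
    {n m : ℕ} (hm : m ≤ n + 1) (B : ℕ → Matrix (Fin N) (Fin N) ℂ) :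
    MatIntegrable γ (fun t => (∑ k ∈ Finset.range m, t ^ k • B k) * (ω t * evalAt (PR n) t)) ∧
    γ.matIntegral (fun t => (∑ k ∈ Finset.range m, t ^ k • B k) * (ω t * evalAt (PR n) t))
      = if m = n + 1 then B n * (C n)⁻¹ else 0 := by
  have hint : ∀ k ∈ Finset.range m,
      MatIntegrable γ fun t => B k * (t ^ k • (ω t * evalAt (PR n) t)) :=
    fun k _ => (h.matIntegrable_right (PR n) k).const_mul (B k)
  have e : (fun t => (∑ k ∈ Finset.range m, t ^ k • B k) * (ω t * evalAt (PR n) t)) =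
      fun t => ∑ k ∈ Finset.range m, B k * (t ^ k • (ω t * evalAt (PR n) t)) := by
    funext t
    simp only [Finset.sum_mul, Matrix.mul_smul, Matrix.smul_mul]
  rw [e]
  refine ⟨MatIntegrable.sum _ hint, ?_⟩
  rw [matIntegral_sum _ hint]
  have : ∀ k ∈ Finset.range m, γ.matIntegral (fun t => B k * (t ^ k • (ω t * evalAt (PR n) t))) =
      if n = k then B n * (C n)⁻¹ else 0 := fun k hk => by
    rw [matIntegral_const_mul (h.matIntegrable_right (PR n) k),
      hR.orthogonal n k (by have := Finset.mem_range.1 hk; omega)]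
    split_ifs with hnk
    · rw [hnk]
    · rw [mul_zero]
  rw [Finset.sum_congr rfl this, Finset.sum_ite_eq]
  simp only [Finset.mem_range]
  exact if_congr (by omega) rfl rfl

/-- Adding and subtracting `P_n^L(t) ω(t) P_m^R(t) / (t - z)` under the integral turns the left side
into the divided difference of `P_n^L` paired with `P_m^R`, minus `P_n^L` paired with the divided
difference of `P_m^R`. These quotients are monic of degree `n - 1 ≤ m` and `m - 1 ≤ n` (zero for
index zero), so biorthogonality evaluates both pairings. -/
theorem secondKind_cross (h : IsRegular γ ω) (hL : IsLeftOrthogonal γ ω PL C)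
    (hR : IsRightOrthogonal γ ω PR C) {n m : ℕ} (hn : n ≤ m + 1) (hm : m ≤ n + 1) {z : ℂ}
    (hz : z ∈ γ.supportᶜ) :
    secondKindL γ ω PL n z * evalAt (PR m) z - evalAt (PL n) z * secondKindR γ ω PR m z =
      (if n = m + 1 then (C m)⁻¹ else 0) - if m = n + 1 then (C n)⁻¹ else 0 := by
  obtain ⟨S, hS, hSd⟩ := exists_divided_difference n (PL n).coeff z
  obtain ⟨T, hT, hTd⟩ := exists_divided_difference m (PR m).coeff z
  simp only [← evalAt_eq_sum _ (hL.monic n).1] at hSd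
  simp only [← evalAt_eq_sum _ (hR.monic m).1] at hTd
  obtain ⟨i1, e1⟩ := hL.integral_mul_sum h hm T
  obtain ⟨i2, e2⟩ := hR.integral_sum_mul h hn S
  have j1 : MatIntegrable γ fun t => (t - z)⁻¹ • (evalAt (PL n) t * ω t) :=
    MatIntegrable.resolvent (by simpa using h.matIntegrable_left (PL n) 0) hz
  have j2 : MatIntegrable γ fun t => (t - z)⁻¹ • (ω t * evalAt (PR m) t) :=
    MatIntegrable.resolvent (by simpa using h.matIntegrable_right (PR m) 0) hz
  rw [secondKindL, secondKindR, ← matIntegral_mul_const j1, ← matIntegral_const_mul j2,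
    ← matIntegral_sub (j1.mul_const _) (j2.const_mul _)]
  have : γ.matIntegral (fun t => (t - z)⁻¹ • (evalAt (PL n) t * ω t) * evalAt (PR m) z
      - evalAt (PL n) z * (t - z)⁻¹ • (ω t * evalAt (PR m) t)) = γ.matIntegral fun t =>
      (∑ k ∈ Finset.range n, t ^ k • S k) * (ω t * evalAt (PR m) t)
      - evalAt (PL n) t * ω t * ∑ k ∈ Finset.range m, t ^ k • T k := by
    refine matIntegral_congr fun t ht => ?_
    have hne := γ.sub_ne_zero hz ht
    generalize γ.toFun t = t at hne ⊢
    have h1 : ∑ k ∈ Finset.range n, t ^ k • S k =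
        (t - z)⁻¹ • (evalAt (PL n) t - evalAt (PL n) z) := by
      rw [hSd, smul_smul, inv_mul_cancel₀ hne, one_smul]
    have h2 : ∑ k ∈ Finset.range m, t ^ k • T k =
        (t - z)⁻¹ • (evalAt (PR m) t - evalAt (PR m) z) := by
      rw [hTd, smul_smul, inv_mul_cancel₀ hne, one_smul]
    rw [h1, h2]
    simp only [Matrix.smul_mul, Matrix.mul_smul, ← smul_sub, mul_sub, sub_mul, mul_assoc]
    congr 1
    abel
  rw [this, matIntegral_sub i2 i1, e1, e2]
  congr 1
  · refine if_ctx_congr Iff.rfl (fun hnm => ?_) fun _ => rfl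
    rw [hS m hnm, (hL.monic n).2, one_mul]
  · refine if_ctx_congr Iff.rfl (fun hnm => ?_) fun _ => rfl
    rw [hT n hnm, (hR.monic m).2, mul_one]

/-- The inverse of `Y_n^L`, made of the blocks of `Y_n^R`. -/
def invYL (γ : SmoothArc) (ω : ℂ → Matrix (Fin N) (Fin N) ℂ)
    (PR : ℕ → (Matrix (Fin N) (Fin N) ℂ)[X]) (C : ℕ → Matrix (Fin N) (Fin N) ℂ) (n : ℕ) (z : ℂ) :
    Matrix (Fin N ⊕ Fin N) (Fin N ⊕ Fin N) ℂ :=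
  Matrix.fromBlocks (-prevQR γ ω PR C n z) (-secondKindR γ ω PR n z)
    (prevPR PR C n z) (evalAt (PR n) z)

/-! ### Inverse and determinant of the fundamental matrices -/

theorem evalAt_zero_eq_one {P : ℕ → (Matrix (Fin N) (Fin N) ℂ)[X]} (hP : IsMonicSequence P)
    (z : ℂ) : evalAt (P 0) z = 1 := by
  rw [evalAt_eq_sum _ (hP 0).1]
  simp [(hP 0).2]

/-- For positive index the four blocks are the cross relations for the pairs `(n, n - 1)`, `(n, n)`,
`(n - 1, n - 1)` and `(n - 1, n)`. For index zero the conventions and `P_0 = 1` replace them. -/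
theorem YL_mul_invYL (h : IsRegular γ ω) (hL : IsLeftOrthogonal γ ω PL C)
    (hR : IsRightOrthogonal γ ω PR C) (n : ℕ) {z : ℂ} (hz : z ∈ γ.supportᶜ) :
    YL γ ω PL C n z * invYL γ ω PR C n z = 1 := by
  have hC : ∀ n, IsUnit (C n).det := fun n => (hL.nonsingular n).isUnit
  have hnn := fun n => secondKind_cross h hL hR (Nat.le_succ n) (Nat.le_succ n) hz
  simp only [left_eq_add, one_ne_zero, if_false, sub_zero, sub_eq_zero] at hnn
  rw [YL, invYL, Matrix.fromBlocks_multiply, ← Matrix.fromBlocks_one]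
  rcases n with _ | n
  · have h0 := hnn 0
    rw [evalAt_zero_eq_one hL.monic, evalAt_zero_eq_one hR.monic, mul_one, one_mul] at h0
    simp [prevQR, prevPR, prevPL, prevQL, evalAt_zero_eq_one hL.monic,
      evalAt_zero_eq_one hR.monic, h0]
  · have h1 := secondKind_cross h hL hR (n := n + 1) (m := n) le_rfl (by omega) hz
    have h2 := secondKind_cross h hL hR (n := n) (m := n + 1) (by omega) le_rfl hz
    rw [if_pos rfl, if_neg (by omega), sub_zero] at h1
    rw [if_neg (by omega), if_pos rfl, zero_sub] at h2
    simp only [prevQR, prevPR, prevPL, prevQL]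
    congr 1
    · rw [mul_neg, ← mul_assoc, ← mul_assoc, neg_add_eq_sub, ← sub_mul, h1,
        Matrix.nonsing_inv_mul _ (hC n)]
    · rw [mul_neg, hnn (n + 1), neg_add_cancel]
    · rw [neg_mul_neg, neg_mul, mul_assoc (C n), mul_assoc (C n), ← mul_assoc (evalAt _ _),
        ← mul_assoc (secondKindL _ _ _ _ _), hnn n, add_neg_cancel]
    · rw [neg_mul_neg, neg_mul, mul_assoc (C n), mul_assoc (C n), ← sub_eq_add_neg, ← mul_sub,
        ← neg_sub, h2, neg_neg, Matrix.mul_nonsing_inv _ (hC n)]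

/-- A product of three unipotent block shears, so the sign does not depend on the block size. -/
theorem det_fromBlocks_swap (m : Type*) [Fintype m] [DecidableEq m] :
    (Matrix.fromBlocks (0 : Matrix m m ℂ) 1 (-1) (0 : Matrix m m ℂ)).det = 1 := by
  have : Matrix.fromBlocks (0 : Matrix m m ℂ) 1 (-1) (0 : Matrix m m ℂ) =
      Matrix.fromBlocks 1 1 0 1 * Matrix.fromBlocks 1 0 (-1) 1 * Matrix.fromBlocks 1 1 0 1 := by
    simp [Matrix.fromBlocks_multiply]
  rw [this, Matrix.det_mul, Matrix.det_mul, Matrix.det_fromBlocks_zero₂₁,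
    Matrix.det_fromBlocks_zero₁₂]
  simp

theorem det_invYL (n : ℕ) (z : ℂ) :
    (invYL γ ω PR C n z).det = (YR γ ω PR C n z).det := by
  have : invYL γ ω PR C n z * Matrix.fromBlocks 0 1 (-1) 0 =
      Matrix.fromBlocks 0 1 (-1) 0 * YR γ ω PR C n z := by
    simp [invYL, YR, Matrix.fromBlocks_multiply]
  have h2 := congrArg Matrix.det this
  rwa [Matrix.det_mul, Matrix.det_mul, det_fromBlocks_swap, mul_one, one_mul] at h2

/-- The inverse formula alone only gives `det Y_n^L · det Y_n^R = 1`. The value is found by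
induction through the transfer matrix `Y_{n+1} Y_n⁻¹`: after the block swap it is block triangular
with diagonal `-C_n⁻¹`, `-C_n`, whose determinants multiply to one. -/
theorem det_YL_eq_one (h : IsRegular γ ω) (hL : IsLeftOrthogonal γ ω PL C)
    (hR : IsRightOrthogonal γ ω PR C) (n : ℕ) {z : ℂ} (hz : z ∈ γ.supportᶜ) :
    (YL γ ω PL C n z).det = 1 := by
  induction n with
  | zero =>
    rw [YL, evalAt_zero_eq_one hL.monic]
    simp [prevPL, prevQL]
  | succ n ih =>
    have hinv := congrArg Matrix.det (YL_mul_invYL h hL hR n hz)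
    rw [Matrix.det_mul, ih, one_mul, Matrix.det_one] at hinv
    have h1 := secondKind_cross h hL hR (n := n + 1) (m := n) le_rfl (by omega) hz
    rw [if_pos rfl, if_neg (by omega), sub_zero] at h1
    have hC : IsUnit (C n).det := (hL.nonsingular n).isUnit
    have hrow : YL γ ω PL C n z * invYL γ ω PR C n z = 1 := YL_mul_invYL h hL hR n hz
    rw [YL, invYL, Matrix.fromBlocks_multiply, ← Matrix.fromBlocks_one, Matrix.fromBlocks_inj]
      at hrow
    obtain ⟨r1, r2, -, -⟩ := hrow
    -- The second block row of `Y_{n+1}` is `-C_n` times the first block row of `Y_n`, so the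
    -- transfer matrix has second row `(-C_n, 0)`; its upper right block is `C_n⁻¹` by the cross
    -- relation `h1`.
    have key : YL γ ω PL C (n + 1) z * invYL γ ω PR C n z * Matrix.fromBlocks 0 1 (-1) 0 =
        Matrix.fromBlocks (-(C n)⁻¹) (evalAt (PL (n + 1)) z * -prevQR γ ω PR C n z
          + secondKindL γ ω PL (n + 1) z * prevPR PR C n z) 0 (-C n) := by
      rw [YL, invYL, Matrix.fromBlocks_multiply, Matrix.fromBlocks_multiply]
      simp only [prevPL, prevQL]
      congr 1
      · rw [← h1]; simp [neg_add_eq_sub]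
      · simp
      · have := congrArg (fun A => C n * A) r2
        simp only [mul_add, mul_zero, ← mul_assoc] at this
        simpa [add_comm] using this
      · have := congrArg (fun A => -(C n * A)) r1
        simp only [mul_add, mul_one, ← mul_assoc] at this
        simpa [add_comm] using this
    have hd := congrArg Matrix.det key
    rw [Matrix.det_mul, Matrix.det_mul, hinv, det_fromBlocks_swap, Matrix.det_fromBlocks_zero₂₁,
      ← Matrix.det_mul, neg_mul_neg, Matrix.nonsing_inv_mul _ hC, Matrix.det_one] at hd
    simpa using hd

theorem det_YR_eq_one (h : IsRegular γ ω) (hL : IsLeftOrthogonal γ ω PL C)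
    (hR : IsRightOrthogonal γ ω PR C) (n : ℕ) {z : ℂ} (hz : z ∈ γ.supportᶜ) :
    (YR γ ω PR C n z).det = 1 := by
  have hinv := congrArg Matrix.det (YL_mul_invYL h hL hR n hz)
  rwa [Matrix.det_mul, det_YL_eq_one h hL hR n hz, one_mul, Matrix.det_one, det_invYL] at hinv

theorem IsRegular.holomorphicOn_YL (h : IsRegular γ ω) (P : ℕ → (Matrix (Fin N) (Fin N) ℂ)[X])
    (C : ℕ → Matrix (Fin N) (Fin N) ℂ) (n : ℕ) : HolomorphicOn (YL γ ω P C n) γ.supportᶜ := by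
  refine (holomorphicOn_evalAt _ _).fromBlocks (h.holomorphicOn_secondKindL P n) ?_ ?_
  · rcases n with _ | n
    · exact holomorphicOn_const (-0) _
    · exact ((holomorphicOn_const _ _).mul (holomorphicOn_evalAt _ _)).neg
  · rcases n with _ | n
    · exact holomorphicOn_const (- -1) _
    · exact ((holomorphicOn_const _ _).mul (h.holomorphicOn_secondKindL P n)).neg

theorem IsRegular.holomorphicOn_YR (h : IsRegular γ ω) (P : ℕ → (Matrix (Fin N) (Fin N) ℂ)[X])
    (C : ℕ → Matrix (Fin N) (Fin N) ℂ) (n : ℕ) : HolomorphicOn (YR γ ω P C n) γ.supportᶜ := by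
  refine (holomorphicOn_evalAt _ _).fromBlocks ?_ (h.holomorphicOn_secondKindR P n) ?_
  · rcases n with _ | n
    · exact holomorphicOn_const (-0) _
    · exact ((holomorphicOn_evalAt _ _).mul (holomorphicOn_const _ _)).neg
  · rcases n with _ | n
    · exact holomorphicOn_const (- -1) _
    · exact ((h.holomorphicOn_secondKindR P n).mul (holomorphicOn_const _ _)).neg

end Biorthogonal

/-! ### The Pearson factorization -/

section Pearson

variable {N : ℕ} {φ : ℂ[X]} {hL hR : ℂ → Matrix (Fin N) (Fin N) ℂ} {D : Set ℂ}
  {ω ωL ωR : ℂ → Matrix (Fin N) (Fin N) ℂ}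

namespace PearsonFactorization

theorem eq_inv_mul (h : PearsonFactorization φ hL hR D ω ωL ωR) :
    ∀ z ∈ D, ωR z = (ωL z)⁻¹ * ω z := fun z hz => by
  rw [h.factor z hz, ← mul_assoc, Matrix.nonsing_inv_mul _ (h.nonsingularL z hz).isUnit, one_mul]

theorem holomorphicR (h : PearsonFactorization φ hL hR D ω ωL ωR) : HolomorphicOn ωR D :=
  ((h.holomorphicL.inv h.nonsingularL).mul h.holomorphic).congr h.eq_inv_mul

/-- Only the left factor is assumed to satisfy an equation. Subtracting it from the Pearson equation
for the product leaves `ω^L (φ (ω^R)') = ω^L ω^R h^R`, and `ω^L` cancels. -/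
theorem pearsonR (h : PearsonFactorization φ hL hR D ω ωL ωR) :
    ∀ z ∈ D, φ.eval z • mderiv ωR z = ωR z * hR z := fun z hz => by
  have h1 := h.pearson z hz
  rw [mderiv_congr h.isOpen h.factor hz, mderiv_mul (h.holomorphicL.diffAt h.isOpen hz)
    (h.holomorphicR.diffAt h.isOpen hz), smul_add, ← Matrix.smul_mul, h.pearsonL z hz,
    h.factor z hz, ← mul_assoc, add_right_inj, ← Matrix.mul_smul, mul_assoc] at h1
  have h2 := congrArg (fun A => (ωL z)⁻¹ * A) h1
  simpa only [← mul_assoc, Matrix.nonsing_inv_mul _ (h.nonsingularL z hz).isUnit, one_mul] using h2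

theorem pearsonR_inv (h : PearsonFactorization φ hL hR D ω ωL ωR) :
    ∀ z ∈ D, φ.eval z • mderiv (fun w => (ωR w)⁻¹) z = -hR z * (ωR z)⁻¹ := fun z hz => by
  rw [mderiv_inv h.isOpen h.holomorphicR h.nonsingularR hz, smul_neg, ← Matrix.smul_mul,
    ← Matrix.mul_smul, h.pearsonR z hz, ← mul_assoc,
    Matrix.nonsing_inv_mul _ (h.nonsingularR z hz).isUnit, one_mul, neg_mul]

theorem pearsonL_inv (h : PearsonFactorization φ hL hR D ω ωL ωR) :
    ∀ z ∈ D, φ.eval z • mderiv (fun w => (ωL w)⁻¹) z = (ωL z)⁻¹ * -hL z := fun z hz => by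
  rw [mderiv_inv h.isOpen h.holomorphicL h.nonsingularL hz, smul_neg, ← Matrix.smul_mul,
    ← Matrix.mul_smul, h.pearsonL z hz, mul_assoc, mul_assoc,
    Matrix.mul_nonsing_inv _ (h.nonsingularL z hz).isUnit, mul_one, mul_neg]

variable {U : Set ℂ} {Y : ℂ → Matrix (Fin N ⊕ Fin N) (Fin N ⊕ Fin N) ℂ}

theorem det_inv_ne_zero {m : Type*} [Fintype m] [DecidableEq m] {A : Matrix m m ℂ}
    (h : A.det ≠ 0) : A⁻¹.det ≠ 0 := by
  rw [Matrix.det_nonsing_inv, Ring.inverse_eq_inv']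
  exact inv_ne_zero h

theorem structL_spec (h : PearsonFactorization φ hL hR D ω ωL ωR) (hU : IsOpen U) (hUD : U ⊆ D)
    (hY : HolomorphicOn Y U) (hYd : ∀ z ∈ U, (Y z).det ≠ 0) :
    HolomorphicOn (structL φ ωL ωR Y) U ∧ ∀ z ∈ U, φ.eval z • mderiv Y z
      + Y z * Matrix.fromBlocks (hL z) 0 0 (-hR z) = structL φ ωL ωR Y z * Y z := by
  refine first_order_left φ hU hY (G := fun z => Matrix.fromBlocks (ωL z) 0 0 (ωR z)⁻¹)
    (H := fun z => Matrix.fromBlocks (hL z) 0 0 (-hR z))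
    ((h.holomorphicL.mono hUD).fromBlocks (holomorphicOn_const _ _) (holomorphicOn_const _ _)
      ((h.holomorphicR.inv h.nonsingularR).mono hUD)) hYd (fun z hz => ?_) (fun z hz => ?_) rfl
  · rw [Matrix.det_fromBlocks_zero₂₁]
    exact mul_ne_zero (h.nonsingularL z (hUD hz)) (det_inv_ne_zero (h.nonsingularR z (hUD hz)))
  · rw [mderiv_fromBlocks, Matrix.fromBlocks_smul, h.pearsonL z (hUD hz),
      h.pearsonR_inv z (hUD hz)]
    simp [mderiv_const, Matrix.fromBlocks_multiply]

theorem structR_spec (h : PearsonFactorization φ hL hR D ω ωL ωR) (hU : IsOpen U) (hUD : U ⊆ D)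
    (hY : HolomorphicOn Y U) (hYd : ∀ z ∈ U, (Y z).det ≠ 0) :
    HolomorphicOn (structR φ ωL ωR Y) U ∧ ∀ z ∈ U, φ.eval z • mderiv Y z
      + Matrix.fromBlocks (hR z) 0 0 (-hL z) * Y z = Y z * structR φ ωL ωR Y z := by
  refine first_order_right φ hU hY (G := fun z => Matrix.fromBlocks (ωR z) 0 0 (ωL z)⁻¹)
    (H := fun z => Matrix.fromBlocks (hR z) 0 0 (-hL z))
    ((h.holomorphicR.mono hUD).fromBlocks (holomorphicOn_const _ _) (holomorphicOn_const _ _)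
      ((h.holomorphicL.inv h.nonsingularL).mono hUD)) hYd (fun z hz => ?_) (fun z hz => ?_) rfl
  · rw [Matrix.det_fromBlocks_zero₂₁]
    exact mul_ne_zero (h.nonsingularR z (hUD hz)) (det_inv_ne_zero (h.nonsingularL z (hUD hz)))
  · rw [mderiv_fromBlocks, Matrix.fromBlocks_smul, h.pearsonR z (hUD hz),
      h.pearsonL_inv z (hUD hz)]
    simp [mderiv_const, Matrix.fromBlocks_multiply]

end PearsonFactorization

theorem opN_fromBlocks_diagonal {m n : Type*} [Fintype m] [Fintype n] (φ : ℂ[X])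
    (A : ℂ → Matrix m m ℂ) (B : ℂ → Matrix n n ℂ) (z : ℂ) :
    opN φ (fun w => Matrix.fromBlocks (A w) 0 0 (B w)) z =
      Matrix.fromBlocks (opN φ A z) 0 0 (opN φ B z) := by
  simp [opN, mderiv_fromBlocks, mderiv_const, Matrix.fromBlocks_multiply, Matrix.fromBlocks_smul,
    Matrix.fromBlocks_add]

theorem two_smul_fromBlocks_add {m n : Type*} [DecidableEq m] [DecidableEq n]
    (A : Matrix m m ℂ) (B : Matrix n n ℂ) (c : ℂ) :
    (2 : ℂ) • Matrix.fromBlocks A 0 0 (-B) + c • 1 =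
      Matrix.fromBlocks ((2 : ℂ) • A + c • 1) 0 0 (-((2 : ℂ) • B) + c • 1) := by
  rw [← Matrix.fromBlocks_one, Matrix.fromBlocks_smul, Matrix.fromBlocks_smul,
    Matrix.fromBlocks_add]
  simp

end Pearson

/-! ### Second order relations for general weights -/

theorem general_second_order :
    (∀ (N : ℕ) (γ : SmoothArc) (ω : ℂ → Matrix (Fin N) (Fin N) ℂ)
      (PL PR : ℕ → Polynomial (Matrix (Fin N) (Fin N) ℂ)) (C : ℕ → Matrix (Fin N) (Fin N) ℂ)
      (φ : Polynomial ℂ) (hL hR : ℂ → Matrix (Fin N) (Fin N) ℂ) (D : Set ℂ)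
      (ωL ωR : ℂ → Matrix (Fin N) (Fin N) ℂ),
      IsRegular γ ω →
      IsLeftOrthogonal γ ω PL C →
      IsRightOrthogonal γ ω PR C →
      PearsonFactorization φ hL hR D ω ωL ωR →
      ∀ n : ℕ,
        let YL := YL γ ω PL C n
        let YR := YR γ ω PR C n
        let QL := secondKindL γ ω PL n
        let QR := secondKindR γ ω PR n
        let ML := structL φ ωL ωR YL
        let MR := structR φ ωL ωR YR
        -- the fundamental matrices are holomorphic off the curve, with determinant one
        HolomorphicOn YL γ.supportᶜ ∧ HolomorphicOn YR γ.supportᶜ ∧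
        (∀ z ∈ γ.supportᶜ, (YL z).det = 1 ∧ (YR z).det = 1) ∧
        HolomorphicOn ML (D \ γ.support) ∧ HolomorphicOn MR (D \ γ.support) ∧
        ∀ z ∈ D \ γ.support, φ.eval z ≠ 0 →
          -- left equation
          (φ.eval z • mderiv (mderiv YL) z
            + mderiv YL z * Matrix.fromBlocks
                ((2 : ℂ) • hL z + φ.derivative.eval z • 1) 0
                0 (-((2 : ℂ) • hR z) + φ.derivative.eval z • 1)
            + YL z * Matrix.fromBlocks (opN φ hL z) 0 0 (opN φ (-hR) z)
            = opN φ ML z * YL z) ∧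
          -- right equation
          (φ.eval z • mderiv (mderiv YR) z
            + Matrix.fromBlocks
                ((2 : ℂ) • hR z + φ.derivative.eval z • 1) 0
                0 (-((2 : ℂ) • hL z) + φ.derivative.eval z • 1) * mderiv YR z
            + Matrix.fromBlocks (opN φ hR z) 0 0 (opN φ (-hL) z) * YR z
            = YR z * opN φ MR z) ∧
          -- the resulting equations for polynomials and second kind functions
          (φ.eval z • mderiv (mderiv (evalAt (PL n))) z
            + mderiv (evalAt (PL n)) z
                * ((2 : ℂ) • hL z + φ.derivative.eval z • 1)
            + evalAt (PL n) z * opN φ hL z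
            = (opN φ ML z).toBlocks₁₁ * evalAt (PL n) z
              - (opN φ ML z).toBlocks₁₂ * prevPL PL C n z) ∧
          (φ.eval z • mderiv (mderiv QL) z
            + mderiv QL z * (-((2 : ℂ) • hR z) + φ.derivative.eval z • 1)
            + QL z * opN φ (-hR) z
            = (opN φ ML z).toBlocks₁₁ * QL z
              - (opN φ ML z).toBlocks₁₂ * prevQL γ ω PL C n z) ∧
          (φ.eval z • mderiv (mderiv (evalAt (PR n))) z
            + ((2 : ℂ) • hR z + φ.derivative.eval z • 1)
                * mderiv (evalAt (PR n)) z
            + opN φ hR z * evalAt (PR n) z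
            = evalAt (PR n) z * (opN φ MR z).toBlocks₁₁
              - prevPR PR C n z * (opN φ MR z).toBlocks₂₁) ∧
          (φ.eval z • mderiv (mderiv QR) z
            + (-((2 : ℂ) • hL z) + φ.derivative.eval z • 1) * mderiv QR z
            + opN φ (-hL) z * QR z
            = QR z * (opN φ MR z).toBlocks₁₁
              - prevQR γ ω PR C n z * (opN φ MR z).toBlocks₂₁)) := by
  intro N γ ω PL PR C φ hL hR D ωL ωR hreg hPL hPR hP n YL YR QL QR ML MR
  have hU : IsOpen (D \ γ.support) := hP.isOpen.inter γ.isOpen_compl_support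
  have hUD : D \ γ.support ⊆ D := Set.sdiff_subset
  have hUs : D \ γ.support ⊆ γ.supportᶜ := fun z hz => hz.2
  have hYL := hreg.holomorphicOn_YL PL C n
  have hYR := hreg.holomorphicOn_YR PR C n
  have hdL : ∀ z ∈ γ.supportᶜ, (YL z).det = 1 := fun z hz => det_YL_eq_one hreg hPL hPR n hz
  have hdR : ∀ z ∈ γ.supportᶜ, (YR z).det = 1 := fun z hz => det_YR_eq_one hreg hPL hPR n hz
  obtain ⟨hML, eL⟩ := hP.structL_spec hU hUD (hYL.mono hUs)
    fun z hz => by rw [hdL z (hUs hz)]; exact one_ne_zero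
  obtain ⟨hMR, eR⟩ := hP.structR_spec hU hUD (hYR.mono hUs)
    fun z hz => by rw [hdR z (hUs hz)]; exact one_ne_zero
  refine ⟨hYL, hYR, fun z hz => ⟨hdL z hz, hdR z hz⟩, hML, hMR, fun z hz hφ => ?_⟩
  have hol : ∀ {h : ℂ → Matrix (Fin N) (Fin N) ℂ}, HolomorphicOn h Set.univ →
      HolomorphicOn h (D \ γ.support) := fun h => h.mono (Set.subset_univ _)
  have left := second_order_left φ hU (hYL.mono hUs)
    ((hol hP.entireL).fromBlocks (holomorphicOn_const 0 _) (holomorphicOn_const 0 _)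
      (hol hP.entireR).neg) hML eL hz hφ
  have right := second_order_right φ hU (hYR.mono hUs)
    ((hol hP.entireR).fromBlocks (holomorphicOn_const 0 _) (holomorphicOn_const 0 _)
      (hol hP.entireL).neg) hMR eR hz hφ
  rw [two_smul_fromBlocks_add, opN_fromBlocks_diagonal] at left right
  refine ⟨left, right, ?_⟩
  -- Entrywise differentiation respects blocks, so the matrix identity can be read block by block.
  have hDL : mderiv (mderiv YL) = fun z => Matrix.fromBlocks
      (mderiv (mderiv (evalAt (PL n))) z) (mderiv (mderiv QL) z)
      (mderiv (mderiv fun z => -prevPL PL C n z) z)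
      (mderiv (mderiv fun z => -prevQL γ ω PL C n z) z) := by
    rw [← mderiv_fromBlocks, ← mderiv_fromBlocks]; rfl
  have hDL' : mderiv YL = fun z => Matrix.fromBlocks
      (mderiv (evalAt (PL n)) z) (mderiv QL z) (mderiv (fun z => -prevPL PL C n z) z)
      (mderiv (fun z => -prevQL γ ω PL C n z) z) := by
    rw [← mderiv_fromBlocks]; rfl
  have hDR : mderiv (mderiv YR) = fun z => Matrix.fromBlocks
      (mderiv (mderiv (evalAt (PR n))) z) (mderiv (mderiv fun z => -prevPR PR C n z) z)
      (mderiv (mderiv QR) z) (mderiv (mderiv fun z => -prevQR γ ω PR C n z) z) := by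
    rw [← mderiv_fromBlocks, ← mderiv_fromBlocks]; rfl
  have hDR' : mderiv YR = fun z => Matrix.fromBlocks
      (mderiv (evalAt (PR n)) z) (mderiv (fun z => -prevPR PR C n z) z) (mderiv QR z)
      (mderiv (fun z => -prevQR γ ω PR C n z) z) := by
    rw [← mderiv_fromBlocks]; rfl
  change φ.eval z • mderiv (mderiv YL) z + mderiv YL z * _ + YL z * _ = opN φ ML z * YL z at left
  change φ.eval z • mderiv (mderiv YR) z + _ * mderiv YR z + _ * YR z = YR z * opN φ MR z at right
  rw [hDL, hDL', ← Matrix.fromBlocks_toBlocks (opN φ ML z)] at left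
  rw [hDR, hDR', ← Matrix.fromBlocks_toBlocks (opN φ MR z)] at right
  simp only [YL, RHMatrix.YL, Matrix.fromBlocks_smul, Matrix.fromBlocks_multiply,
    Matrix.fromBlocks_add, Matrix.fromBlocks_inj, mul_zero, add_zero, zero_add, mul_neg,
    ← sub_eq_add_neg] at left
  simp only [YR, RHMatrix.YR, Matrix.fromBlocks_smul, Matrix.fromBlocks_multiply,
    Matrix.fromBlocks_add, Matrix.fromBlocks_inj, zero_mul, add_zero, zero_add, neg_mul,
    ← sub_eq_add_neg] at right
  -- Kept are the first block row on the left and the first block column on the right, where the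
  -- second derivatives are those of the functions of index `n`.
  obtain ⟨l1, l2, -, -⟩ := left
  obtain ⟨r1, -, r3, -⟩ := right
  exact ⟨l1, l2, r1, r3⟩

/-! ### Classical orthogonal polynomials, algebraically -/

section Classical

/-- The operator `q ↦ (a + b x + c x²) q'' + (d + e x) q'`. -/
def hypOp (a b c d e : ℂ) (q : ℂ[X]) : ℂ[X] :=
  (C a + C b * X + C c * X ^ 2) * q.derivative.derivative + (C d + C e * X) * q.derivative

theorem coeff_X_mul_derivative (q : ℂ[X]) (m : ℕ) :
    (X * q.derivative).coeff m = m * q.coeff m := by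
  rcases m with _ | m
  · simp
  · rw [coeff_X_mul, coeff_derivative]; push_cast; ring

theorem coeff_hypOp (a b c d e : ℂ) (q : ℂ[X]) (m : ℕ) :
    (hypOp a b c d e q).coeff m = a * ((m + 2) * (m + 1) * q.coeff (m + 2))
      + (b * m + d) * ((m + 1) * q.coeff (m + 1)) + (c * (m * (m - 1)) + e * m) * q.coeff m := by
  -- The Euler operator `θ = x d/dx` acts diagonally on coefficients, and `x² q'' = θ² q - θ q`.
  have : hypOp a b c d e q = C a * q.derivative.derivative + C b * (X * q.derivative.derivative)
      + C c * (X * (X * q.derivative).derivative - X * q.derivative) + C d * q.derivative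
      + C e * (X * q.derivative) := by
    rw [hypOp, derivative_mul, derivative_X]; ring
  rw [this]
  simp only [coeff_add, coeff_sub, coeff_C_mul, coeff_X_mul_derivative, coeff_derivative]
  push_cast
  ring

/-- The eigenvalue of `hypOp` on polynomials of degree `n`. -/
def hypEigenvalue (c e : ℂ) (n : ℕ) : ℂ := c * (n * (n - 1)) + e * n

variable {p : ℕ → ℂ[X]}

theorem coeff_of_monic (hm : ∀ n, (p n).Monic) (hd : ∀ n, (p n).natDegree = n) (n : ℕ) :
    (p n).coeff n = 1 := by
  have := hm n
  rwa [Monic, leadingCoeff, hd] at this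

/-- One step of the expansion of a polynomial in the `p k`, driving the inductions below. -/
theorem degree_sub_C_mul_lt (hm : ∀ n, (p n).Monic) (hd : ∀ n, (p n).natDegree = n) {k : ℕ}
    {q : ℂ[X]} (hq : q.degree < (k + 1 : ℕ)) : (q - C (q.coeff k) * p k).degree < k := by
  rw [degree_lt_iff_coeff_zero] at hq ⊢
  intro m hkm
  rw [coeff_sub, coeff_C_mul]
  rcases hkm.eq_or_lt with rfl | h
  · rw [coeff_of_monic hm hd, mul_one, sub_self]
  · rw [hq m h, coeff_eq_zero_of_natDegree_lt (p := p k) (by rw [hd]; exact h), mul_zero, sub_zero]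

theorem orthogonal_lower (ℓ : ℂ[X] →ₗ[ℂ] ℂ) (hm : ∀ n, (p n).Monic)
    (hd : ∀ n, (p n).natDegree = n) (ho : ∀ n m, n ≠ m → ℓ (p n * p m) = 0) {n : ℕ} (k : ℕ) :
    k ≤ n → ∀ q : ℂ[X], q.degree < k → ℓ (p n * q) = 0 := by
  induction k with
  | zero =>
    intro _ q hq
    have : q = 0 := by simpa [Nat.WithBot.lt_zero_iff] using hq
    simp [this]
  | succ k ih =>
    intro hk q hq
    have h1 := ih (by omega) _ (degree_sub_C_mul_lt hm hd hq)
    rw [mul_sub, map_sub, mul_left_comm, ← smul_eq_C_mul, map_smul, ho n k (by omega), smul_zero,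
      sub_zero] at h1
    exact h1

/-- The top coefficient of `q` times `ℓ (p k * p k)` equals `ℓ (p k * q) = 0`, so the degree drops
until nothing is left. -/
theorem eq_zero_of_orthogonal (ℓ : ℂ[X] →ₗ[ℂ] ℂ) (hm : ∀ n, (p n).Monic)
    (hd : ∀ n, (p n).natDegree = n) (ho : ∀ n m, n ≠ m → ℓ (p n * p m) = 0)
    (hn : ∀ n, ℓ (p n * p n) ≠ 0) (k : ℕ) :
    ∀ q : ℂ[X], q.degree < k → (∀ m < k, ℓ (p m * q) = 0) → q = 0 := by
  induction k with
  | zero =>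
    intro q hq _
    simpa [Nat.WithBot.lt_zero_iff] using hq
  | succ k ih =>
    intro q hq hz
    have hr := degree_sub_C_mul_lt hm hd hq
    have h1 := orthogonal_lower ℓ hm hd ho k le_rfl _ hr
    rw [mul_sub, map_sub, mul_left_comm, ← smul_eq_C_mul, map_smul, hz k (by omega), zero_sub,
      neg_eq_zero, smul_eq_mul] at h1
    have h2 : q.coeff k = 0 := (mul_eq_zero.1 h1).resolve_right (hn k)
    rw [h2, C_0, zero_mul, sub_zero] at hr
    exact ih q hr fun m hm => hz m (by omega)

/-- The Pearson identity for `ℓ` makes the operator symmetric. Subtracting the eigenvalue multiple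
of `p n` removes the top coefficient, and the difference is orthogonal to every `p m` with `m < n`,
since the operator maps `p m` to degree at most `m`. -/
theorem hypOp_eq_of_orthogonal (ℓ : ℂ[X] →ₗ[ℂ] ℂ) {a b c d e : ℂ}
    (hℓ : ∀ q : ℂ[X], ℓ ((C d + C e * X) * q
      + (C a + C b * X + C c * X ^ 2) * q.derivative) = 0)
    (hm : ∀ n, (p n).Monic) (hd : ∀ n, (p n).natDegree = n)
    (ho : ∀ n m, n ≠ m → ℓ (p n * p m) = 0) (hn : ∀ n, ℓ (p n * p n) ≠ 0) (n : ℕ) :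
    hypOp a b c d e (p n) = C (hypEigenvalue c e n) * p n := by
  have hsymm : ∀ f g : ℂ[X], ℓ (g * hypOp a b c d e f) = ℓ (f * hypOp a b c d e g) := by
    intro f g
    -- The Wronskian of `f` and `g` is the test polynomial: its derivative is `g f'' - f g''`, which
    -- antisymmetrises the operator.
    have h := hℓ (g * f.derivative - f * g.derivative)
    have e : (C d + C e * X) * (g * f.derivative - f * g.derivative)
        + (C a + C b * X + C c * X ^ 2) * (g * f.derivative - f * g.derivative).derivative
        = g * hypOp a b c d e f - f * hypOp a b c d e g := by
      simp only [hypOp, derivative_sub, derivative_mul]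
      ring
    rwa [e, map_sub, sub_eq_zero] at h
  rw [← sub_eq_zero]
  refine eq_zero_of_orthogonal ℓ hm hd ho hn n _ ?_ fun m hmn => ?_
  · rw [degree_lt_iff_coeff_zero]
    intro m hnm
    have hz : ∀ k, n < k → (p n).coeff k = 0 := fun k hk =>
      coeff_eq_zero_of_natDegree_lt (by rw [hd]; exact hk)
    rw [coeff_sub, coeff_hypOp, coeff_C_mul, hz (m + 2) (by omega), hz (m + 1) (by omega)]
    rcases hnm.eq_or_lt with rfl | h
    · rw [hypEigenvalue]; ring
    · rw [hz m h]; ring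
  · rw [mul_sub, map_sub, hsymm, mul_left_comm, ← smul_eq_C_mul, map_smul, ho m n hmn.ne,
      smul_zero, sub_zero]
    refine orthogonal_lower ℓ hm hd ho n le_rfl _ ?_
    rw [degree_lt_iff_coeff_zero]
    intro k hk
    have hz : ∀ k, m < k → (p m).coeff k = 0 := fun k hk =>
      coeff_eq_zero_of_natDegree_lt (by rw [hd]; exact hk)
    rw [coeff_hypOp, hz k (by omega), hz (k + 1) (by omega), hz (k + 2) (by omega)]
    ring

/-- Comparing top coefficients, a nonzero solution of degree `k` forces `μ` to be the `k`-th
eigenvalue. -/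
theorem hypOp_unique {a b c d e μ : ℂ} {n : ℕ} (hμ : ∀ k < n, hypEigenvalue c e k ≠ μ)
    {q : ℂ[X]} (hq : q.degree < n) (h : hypOp a b c d e q = C μ * q) : q = 0 := by
  by_contra hne
  have hlt : q.natDegree < n := (natDegree_lt_iff_degree_lt hne).2 hq
  have hz : ∀ k, q.natDegree < k → q.coeff k = 0 := fun k hk => coeff_eq_zero_of_natDegree_lt hk
  have h1 := congrArg (fun r => r.coeff q.natDegree) h
  simp only [coeff_hypOp, coeff_C_mul, hz _ (Nat.lt_succ_self _),
    hz (q.natDegree + 2) (by omega)] at h1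
  refine hμ _ hlt (mul_right_cancel₀ (leadingCoeff_ne_zero.2 hne) ?_)
  rw [leadingCoeff, hypEigenvalue, ← h1]
  ring

/-- Solutions of the Hermite equation of exact degree satisfy the Hermite recurrence. -/
theorem hermite_recurrence (hm : ∀ n, (p n).Monic) (hd : ∀ n, (p n).natDegree = n)
    (h : ∀ n, hypOp 1 0 0 0 (-2) (p n) = C (hypEigenvalue 0 (-2) n) * p n) (n : ℕ) :
    X * p n = p (n + 1) + C ((n : ℂ) / 2) * p (n - 1) := by
  have heig : ∀ k : ℕ, hypEigenvalue 0 (-2) k = -2 * k := fun k => by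
    rw [hypEigenvalue]; ring
  have hode : ∀ (q : ℂ[X]) (μ : ℂ), hypOp 1 0 0 0 (-2) q = C μ * q ↔
      q.derivative.derivative = 2 * X * q.derivative + C μ * q := fun q μ => by
    have : hypOp 1 0 0 0 (-2) q = q.derivative.derivative - 2 * X * q.derivative := by
      simp only [hypOp, C_0, C_1, map_neg, C_ofNat]; ring
    rw [this]
    constructor <;> intro h <;> linear_combination h
  have huniq : ∀ (m : ℕ) (q : ℂ[X]), q.degree < m → hypOp 1 0 0 0 (-2) q = C (-2 * (m : ℂ)) * q →
      q = 0 := fun m q hq hh => by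
    refine hypOp_unique (fun k hk hkm => hk.ne ?_) hq hh
    rw [heig] at hkm
    exact_mod_cast mul_left_cancel₀ (by norm_num : (-2 : ℂ) ≠ 0) hkm
  have hz : ∀ n k, n < k → (p n).coeff k = 0 := fun n k hk =>
    coeff_eq_zero_of_natDegree_lt (by rw [hd]; exact hk)
  have h2 := fun n => (hode _ _).1 (h n)
  simp only [heig] at h2
  -- Differentiating the Hermite equation shifts its eigenvalue by one index, so `p (n + 1)'` and
  -- `(n + 1) p n` solve the same equation with equal top coefficients and coincide. For `n = 0` the
  -- truncated `p (n - 1)` has coefficient zero.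
  have hder : (p n).derivative = C (n : ℂ) * p (n - 1) := by
    rcases n with _ | n
    · rw [eq_C_of_natDegree_eq_zero (hd 0)]; simp
    · rw [← sub_eq_zero, Nat.add_sub_cancel]
      refine huniq n _ ?_ ((hode _ _).2 ?_)
      · rw [degree_lt_iff_coeff_zero]
        intro k hk
        rw [coeff_sub, coeff_derivative, coeff_C_mul]
        rcases hk.eq_or_lt with rfl | hk
        · rw [coeff_of_monic hm hd, coeff_of_monic hm hd]; push_cast; ring
        · rw [hz _ _ (by omega), hz _ _ hk]; ring
      · have h3 := congrArg derivative (h2 (n + 1))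
        simp only [derivative_mul, derivative_add, derivative_X, derivative_ofNat,
          map_mul, map_neg,
          derivative_natCast, derivative_zero, derivative_sub, map_natCast, C_ofNat] at h3 ⊢
        have h4 := h2 n
        simp only [map_mul, map_neg, map_natCast, C_ofNat] at h4
        push_cast at h3 ⊢
        linear_combination h3 - ((n : ℂ[X]) + 1) * h4
  -- The raising operator `q ↦ x q - q' / 2` sends solutions of index `n` to solutions of index `n +
  -- 1`; uniqueness identifies the image with `p (n + 1)`, and `hder` rewrites the derivative.
  have hmain : X * p n - C (2⁻¹ : ℂ) * (p n).derivative - p (n + 1) = 0 := by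
    refine huniq (n + 1) _ ?_ ((hode _ _).2 ?_)
    · rw [degree_lt_iff_coeff_zero]
      rintro (_ | k) hk
      · omega
      rw [coeff_sub, coeff_sub, coeff_X_mul, coeff_C_mul, coeff_derivative,
        hz n (k + 1 + 1) (by omega)]
      rcases (Nat.le_of_succ_le_succ hk).eq_or_lt with rfl | hk
      · rw [coeff_of_monic hm hd, coeff_of_monic hm hd]; ring
      · rw [hz _ _ hk, hz _ _ (by omega)]; ring
    · have h3 := h2 n
      have h4 := h2 (n + 1)
      have h5 := congrArg derivative h3
      have h2inv : 2 * C (2⁻¹ : ℂ) = 1 := by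
        rw [← C_ofNat, ← C_mul]; norm_num
      simp only [derivative_mul, derivative_add, derivative_C, derivative_X, derivative_ofNat,
        derivative_sub, derivative_one, derivative_natCast, derivative_zero, map_mul, map_neg,
        map_natCast, C_ofNat] at h3 h4 h5 ⊢
      push_cast at h4 ⊢
      linear_combination X * h3 - C (2⁻¹ : ℂ) * h5 - h4 - 2 * (p n).derivative * h2inv
  rw [hder, ← mul_assoc, ← C_mul] at hmain
  rw [div_eq_inv_mul]
  linear_combination hmain

end Classical

/-! ### Classical weights on real intervals -/

/-- The weight `w` on a real interval satisfies `((a + b t + c t²) w)' = (d + e t) w` in the weak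
sense, without boundary terms. -/
structure IsClassicalWeight (γ : SmoothArc) (w : ℂ → ℂ) (a b c d e : ℂ) : Prop where
  toFun_eq : γ.toFun = fun t : ℝ => (t : ℂ)
  integrable : ∀ p : ℂ[X], γ.IntegrableAlong fun t => p.eval t * w t
  integral_eq_zero : ∀ (p : ℂ[X]) (g g' : ℝ → ℂ) (B : ℝ),
    (∀ t ∈ γ.dom, HasDerivAt g (g' t) t) → ContinuousOn g' γ.dom →
    (∀ t ∈ γ.dom, ‖g t‖ ≤ B ∧ ‖g' t‖ ≤ B) →
    ∫ t in γ.dom, (((d + e * t) * p.eval (t : ℂ) + (a + b * t + c * t ^ 2) *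
      p.derivative.eval (t : ℂ)) * g t + (a + b * t + c * t ^ 2) * p.eval (t : ℂ) * g' t) * w t = 0

namespace IsClassicalWeight

variable {γ : SmoothArc} {w : ℂ → ℂ} {a b c d e : ℂ}

theorem deriv_toFun (h : IsClassicalWeight γ w a b c d e) (t : ℝ) : deriv γ.toFun t = 1 := by
  rw [h.toFun_eq]
  exact (Complex.ofRealCLM.hasDerivAt (x := t)).deriv

theorem integral_eq (h : IsClassicalWeight γ w a b c d e) (f : ℂ → ℂ) :
    γ.integral f = (2 * (Real.pi : ℂ) * Complex.I)⁻¹ * ∫ t in γ.dom, f (t : ℂ) := by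
  simp only [SmoothArc.integral, h.deriv_toFun, one_mul]
  rw [h.toFun_eq]

/-- The moment functional of the weight. -/
def functional (h : IsClassicalWeight γ w a b c d e) : ℂ[X] →ₗ[ℂ] ℂ where
  toFun p := γ.integral fun t => p.eval t * w t
  map_add' p q := by
    simp only [eval_add, add_mul]
    exact SmoothArc.integral_add (h.integrable p) (h.integrable q)
  map_smul' r p := by
    simp only [eval_smul, smul_eq_mul, mul_assoc, RingHom.id_apply]
    exact SmoothArc.integral_const_mul _ _

theorem functional_apply (h : IsClassicalWeight γ w a b c d e) (p : ℂ[X]) :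
    h.functional p = γ.integral fun t => p.eval t * w t := rfl

theorem functional_pearson (h : IsClassicalWeight γ w a b c d e) (p : ℂ[X]) :
    h.functional ((C d + C e * X) * p + (C a + C b * X + C c * X ^ 2) * p.derivative) = 0 := by
  rw [functional_apply, h.integral_eq]
  have := h.integral_eq_zero p (fun _ => 1) (fun _ => 0) 1 (fun t _ => hasDerivAt_const _ _)
    continuousOn_const (fun t _ => by simp)
  simp only [mul_one, mul_zero, add_zero] at this
  simp only [eval_add, eval_mul, eval_C, eval_X, eval_pow]
  rw [this, mul_zero]

theorem hypOp_eq (h : IsClassicalWeight γ w a b c d e) {p : ℕ → ℂ[X]}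
    (hp : IsMonicOrthogonal γ w p) (n : ℕ) :
    hypOp a b c d e (p n) = C (hypEigenvalue c e n) * p n := by
  have hf : ∀ n m, h.functional (p n * p m)
      = γ.integral fun t => (p n).eval t * w t * (p m).eval t := fun n m => by
    rw [functional_apply]
    exact SmoothArc.integral_congr fun t _ => by rw [eval_mul]; ring
  refine hypOp_eq_of_orthogonal h.functional h.functional_pearson hp.monic hp.natDegree_eq
    (fun n m hnm => ?_) (fun n => ?_) n
  · rw [hf, hp.orthogonal n m hnm]
  · rw [hf]; exact hp.norm_ne_zero n

theorem polynomial_equation (h : IsClassicalWeight γ w a b c d e) {p : ℕ → ℂ[X]}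
    (hp : IsMonicOrthogonal γ w p) (n : ℕ) (z : ℂ) :
    (a + b * z + c * z ^ 2) * (p n).derivative.derivative.eval z
      + (d + e * z) * (p n).derivative.eval z = hypEigenvalue c e n * (p n).eval z := by
  simpa [hypOp] using congrArg (Polynomial.eval z) (h.hypOp_eq hp n)

/-! ### Second kind functions of classical weights -/

theorem secondKind_eq (p : ℂ[X]) (z : ℂ) :
    secondKind γ w p z = γ.integral fun t => (t - z)⁻¹ ^ 1 * (p.eval t * w t) :=
  SmoothArc.integral_congr fun t _ => by rw [pow_one, div_eq_mul_inv]; ring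

theorem hasDerivAt_secondKind (h : IsClassicalWeight γ w a b c d e) (p : ℂ[X]) {z : ℂ}
    (hz : z ∈ γ.supportᶜ) : HasDerivAt (secondKind γ w p)
      (γ.integral fun t => (t - z)⁻¹ ^ 2 * (p.eval t * w t)) z := by
  have := SmoothArc.hasDerivAt_cauchy (h.integrable p) hz 1
  rw [← funext (secondKind_eq p)] at this
  simpa using this

theorem differentiableOn_secondKind (h : IsClassicalWeight γ w a b c d e) (p : ℂ[X]) :
    DifferentiableOn ℂ (secondKind γ w p) γ.supportᶜ :=
  fun _ hz => (h.hasDerivAt_secondKind p hz).differentiableAt.differentiableWithinAt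

theorem deriv_deriv_secondKind (h : IsClassicalWeight γ w a b c d e) (p : ℂ[X]) {z : ℂ}
    (hz : z ∈ γ.supportᶜ) : deriv (deriv (secondKind γ w p)) z =
      2 * γ.integral fun t => (t - z)⁻¹ ^ 3 * (p.eval t * w t) := by
  have h1 : deriv (secondKind γ w p) =ᶠ[nhds z]
      fun z => γ.integral fun t => (t - z)⁻¹ ^ 2 * (p.eval t * w t) := by
    filter_upwards [γ.isOpen_compl_support.mem_nhds hz] with y hy
    exact (h.hasDerivAt_secondKind p hy).deriv
  rw [h1.deriv_eq, (SmoothArc.hasDerivAt_cauchy (h.integrable p) hz 2).deriv,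
    ← SmoothArc.integral_const_mul]
  exact congrArg _ (funext fun t => by push_cast; ring)

/-- Off the closed support `(t - z)⁻¹ ^ k` and its derivative are bounded along the interval, so it
is an admissible multiplier in the weak Pearson identity. -/
theorem integral_resolvent_eq_zero (h : IsClassicalWeight γ w a b c d e) (p : ℂ[X]) {z : ℂ}
    (hz : z ∈ γ.supportᶜ) (k : ℕ) :
    γ.integral (fun t => (((d + e * t) * p.eval t + (a + b * t + c * t ^ 2) *
      p.derivative.eval t) * (t - z)⁻¹ ^ k - (a + b * t + c * t ^ 2) * p.eval t *
        (k * (t - z)⁻¹ ^ (k + 1))) * w t) = 0 := by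
  obtain ⟨δ, hδ, -, hb⟩ := γ.exists_norm_inv_le hz
  have hb' := hb z (Metric.mem_ball_self hδ)
  have hne : ∀ t ∈ γ.dom, (t : ℂ) - z ≠ 0 := fun t ht => by
    have := γ.sub_ne_zero hz ht
    rwa [h.toFun_eq] at this
  simp only [h.toFun_eq] at hb'
  have hpow : ∀ j : ℕ, ∀ t ∈ γ.dom, ‖((t : ℂ) - z)⁻¹ ^ j‖ ≤ δ⁻¹ ^ j := fun j t ht => by
    rw [norm_pow]
    exact pow_le_pow_left₀ (norm_nonneg _) (hb' t ht) j
  have := h.integral_eq_zero p (fun t => ((t : ℂ) - z)⁻¹ ^ k)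
    (fun t => -(k * ((t : ℂ) - z)⁻¹ ^ (k + 1))) (max (δ⁻¹ ^ k) (k * δ⁻¹ ^ (k + 1))) ?_ ?_ ?_
  · rw [h.integral_eq]
    rw [show (fun t : ℝ => _) = _ from funext fun t => ?_] at this
    · rw [this, mul_zero]
    · ring
  · intro t ht
    have h1 : HasDerivAt (fun s : ℝ => ((s : ℂ) - z)⁻¹) (-((t : ℂ) - z)⁻¹ ^ 2) t := by
      refine (((Complex.ofRealCLM.hasDerivAt (x := t)).sub_const z).inv (hne t ht)).congr_deriv ?_
      simp [neg_div]
    refine (h1.fun_pow k).congr_deriv ?_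
    rcases k with _ | k
    · simp
    · rw [Nat.add_sub_cancel]; ring
  · refine (continuousOn_const.mul (ContinuousOn.pow (ContinuousOn.inv₀ ?_ hne) _)).neg
    exact (Complex.continuous_ofReal.sub continuous_const).continuousOn
  · refine fun t ht => ⟨(hpow k t ht).trans (le_max_left _ _), ?_⟩
    rw [norm_neg, norm_mul, Complex.norm_natCast]
    exact (mul_le_mul_of_nonneg_left (hpow _ t ht) (Nat.cast_nonneg _)).trans (le_max_right _ _)

/-- With `A = a + b x + c x²`, this is the adjoint equation `(A Q)'' - ((d + e z) Q)' = λ Q`. The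
weak identity is used for `p'` against `(t - z)⁻¹` and for `p` against `(t - z)⁻²`. In the sum the
terms `A p' (t - z)⁻²` cancel and the polynomial equation turns `A p'' + (d + e t) p'` into `λ p`.
-/
theorem secondKind_equation (h : IsClassicalWeight γ w a b c d e) {p : ℕ → ℂ[X]}
    (hp : IsMonicOrthogonal γ w p) (n : ℕ) {z : ℂ} (hz : z ∈ γ.supportᶜ) :
    (a + b * z + c * z ^ 2) * deriv (deriv (secondKind γ w (p n))) z
      + (2 * (b + 2 * c * z) - (d + e * z)) * deriv (secondKind γ w (p n)) z
      + (2 * c - e) * secondKind γ w (p n) z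
      = hypEigenvalue c e n * secondKind γ w (p n) z := by
  rw [(h.hasDerivAt_secondKind _ hz).deriv, h.deriv_deriv_secondKind _ hz, secondKind_eq]
  have hi := fun k => (h.integrable (p n)).resolvent hz k
  have e1 := h.integral_resolvent_eq_zero (p n).derivative hz 1
  have e2 := h.integral_resolvent_eq_zero (p n) hz 2
  have int : ∀ (q : ℂ[X]) (k : ℕ), γ.IntegrableAlong (fun t => (((d + e * t) * q.eval t +
      (a + b * t + c * t ^ 2) * q.derivative.eval t) * (t - z)⁻¹ ^ k -
      (a + b * t + c * t ^ 2) * q.eval t * (k * (t - z)⁻¹ ^ (k + 1))) * w t) := fun q k => by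
    have := ((h.integrable ((C d + C e * X) * q + (C a + C b * X + C c * X ^ 2) *
      q.derivative)).resolvent hz k).add (((h.integrable ((C a + C b * X + C c * X ^ 2) *
      q)).resolvent hz (k + 1)).const_mul (-k))
    refine this.congr fun t _ => ?_
    simp only [eval_add, eval_mul, eval_C, eval_X, eval_pow]
    ring
  have key := SmoothArc.integral_add (int (p n).derivative 1) (int (p n) 2)
  rw [e1, e2, add_zero] at key
  have e3 := SmoothArc.integral_add ((hi 1).const_mul (hypEigenvalue c e n - (2 * c - e)))
    (((hi 2).const_mul (-(2 * (b + 2 * c * z) - (d + e * z)))).add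
      ((hi 3).const_mul (-(2 * (a + b * z + c * z ^ 2)))))
  rw [SmoothArc.integral_add ((hi 2).const_mul _) ((hi 3).const_mul _),
    SmoothArc.integral_const_mul, SmoothArc.integral_const_mul, SmoothArc.integral_const_mul] at e3
  rw [SmoothArc.integral_congr (γ := γ) fun t ht => ?_] at key
  · rw [e3] at key
    linear_combination -key
  · have hne := γ.sub_ne_zero hz ht
    generalize γ.toFun t = t at hne ⊢
    have hpoly := h.polynomial_equation hp n t
    have hu : (t - z) * (t - z)⁻¹ = 1 := mul_inv_cancel₀ hne
    generalize (t - z)⁻¹ = u at hu ⊢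
    push_cast
    -- Expanding `A(t)` and `d + e t` around `z` in powers of `t - z` reduces everything to `(t -
    -- z)⁻¹`, `(t - z)⁻²`, `(t - z)⁻³`, that is to `Q`, `Q'` and `Q'' / 2`.
    linear_combination u * w t * hpoly + (p n).eval t * w t *
      (e * u - 2 * ((b + c * (t + z)) * u ^ 2 + c * u)) * hu

end IsClassicalWeight

/-! ### The Hermite, Laguerre and Jacobi weights -/

open Filter Topology in
-- The integrand of the weak identity is the derivative of `F = p A w g` with `A = a + b t + c t²`.
-- Both are integrable, being sums of bounded functions times polynomial multiples of `w`. What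
-- remains specific to each weight is the vanishing of `F` at the ends, isolated in `hbd`.
theorem IsClassicalWeight.of_boundary {γ : SmoothArc} {w : ℂ → ℂ} {a b c d e : ℂ}
    (hγ : γ.toFun = fun t : ℝ => (t : ℂ))
    (hint : ∀ n : ℕ, IntegrableOn (fun t : ℝ => (t : ℂ) ^ n * w t) γ.dom)
    (hw : ∀ t ∈ γ.dom, HasDerivAt (fun t : ℝ => (a + b * t + c * t ^ 2) * w t)
      ((d + e * t) * w t) t)
    (hbd : ∀ F F' : ℝ → ℂ, (∀ t ∈ γ.dom, HasDerivAt F (F' t) t) → IntegrableOn F γ.dom →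
      IntegrableOn F' γ.dom → (∃ p : ℂ[X], ∀ t ∈ γ.dom,
        ‖F t‖ ≤ ‖p.eval (t : ℂ) * ((a + b * t + c * t ^ 2) * w t)‖) → ∫ t in γ.dom, F' t = 0) :
    IsClassicalWeight γ w a b c d e := by
  have hpoly : ∀ p : ℂ[X], IntegrableOn (fun t : ℝ => p.eval (t : ℂ) * w t) γ.dom := fun p => by
    have := integrable_finsetSum (Finset.range (p.natDegree + 1)) fun k _ =>
      (hint k).const_mul (p.coeff k)
    refine this.congr (Eventually.of_forall fun t => ?_)
    simp only [eval_eq_sum_range, Finset.sum_mul, mul_assoc]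
  have hderiv : ∀ t : ℝ, deriv γ.toFun t = 1 := fun t => by
    rw [hγ]
    exact (Complex.ofRealCLM.hasDerivAt (x := t)).deriv
  refine ⟨hγ, fun p => ?_, fun p g g' B hg hg' hB => ?_⟩
  · have := hpoly p
    simp only [SmoothArc.IntegrableAlong, hderiv, one_mul]
    rw [hγ]
    exact this
  have mg : AEStronglyMeasurable g (volume.restrict γ.dom) :=
    ContinuousOn.aestronglyMeasurable (fun t ht => (hg t ht).continuousAt.continuousWithinAt)
      γ.measurableSet_dom
  have mg' : AEStronglyMeasurable g' (volume.restrict γ.dom) :=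
    hg'.aestronglyMeasurable γ.measurableSet_dom
  have bg : ∀ᵐ t ∂(volume.restrict γ.dom), ‖g t‖ ≤ B :=
    ae_restrict_of_forall_mem γ.measurableSet_dom fun t ht => (hB t ht).1
  have bg' : ∀ᵐ t ∂(volume.restrict γ.dom), ‖g' t‖ ≤ B :=
    ae_restrict_of_forall_mem γ.measurableSet_dom fun t ht => (hB t ht).2
  have i1 := (hpoly ((C a + C b * X + C c * X ^ 2) * p)).bdd_mul mg bg
  have i2 := (hpoly ((C a + C b * X + C c * X ^ 2) * p)).bdd_mul mg' bg'
  have i3 := (hpoly ((C d + C e * X) * p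
    + (C a + C b * X + C c * X ^ 2) * p.derivative)).bdd_mul mg bg
  -- The bound `‖g‖ ≤ B` is absorbed into the polynomial `B p`.
  refine hbd (fun t => p.eval (t : ℂ) * ((a + b * t + c * t ^ 2) * w t) * g t) _
    (fun t ht => ?_) ?_ ?_ ⟨C (B : ℂ) * p, fun t ht => ?_⟩
  · refine (((p.hasDerivAt (t : ℂ)).comp_ofReal.mul (hw t ht)).mul (hg t ht)).congr_deriv ?_
    simp only [Pi.mul_apply]
    ring
  · refine i1.congr (Eventually.of_forall fun t => ?_)
    simp only [eval_add, eval_mul, eval_C, eval_X, eval_pow]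
    ring
  · refine (i3.add i2).congr (Eventually.of_forall fun t => ?_)
    simp only [Pi.add_apply, eval_add, eval_mul, eval_C, eval_X, eval_pow]
    ring
  · rw [eval_mul, eval_C, norm_mul _ (g t), mul_assoc, norm_mul (B : ℂ), mul_comm]
    refine mul_le_mul_of_nonneg_right ((hB t ht).1.trans ?_) (norm_nonneg _)
    rw [Complex.norm_real]
    exact Real.le_norm_self B

/-- On the whole line, integrability of `F` and `F'` already forces `∫ F' = 0`; no pointwise bound
is needed. -/
theorem isClassicalWeight_hermite :
    IsClassicalWeight realLine hermiteWeight 1 0 0 0 (-2) := by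
  refine .of_boundary rfl (fun n => ?_) (fun t _ => ?_) fun F F' hF iF iF' _ => ?_
  · have h := (integrable_rpow_mul_exp_neg_mul_sq one_pos
      (by linarith [(Nat.cast_nonneg n : (0 : ℝ) ≤ n)] : (-1 : ℝ) < n)).ofReal (𝕜 := ℂ)
    refine Integrable.integrableOn (h.congr (Filter.Eventually.of_forall fun t => ?_))
    simp [hermiteWeight]
  · have h : HasDerivAt (fun z : ℂ => Complex.exp (-z ^ 2)) (Complex.exp (-(t : ℂ) ^ 2) * _) t :=
      (((hasDerivAt_id (t : ℂ)).pow 2).neg).cexp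
    refine (h.comp_ofReal.const_mul 1).congr_of_eventuallyEq ?_ |>.congr_deriv ?_
    · exact Filter.Eventually.of_forall fun t => by simp [hermiteWeight]
    · simp [hermiteWeight]; ring
  · have hu : realLine.dom = Set.univ := rfl
    rw [hu] at hF iF iF' ⊢
    rw [integrableOn_univ] at iF iF'
    rw [setIntegral_univ]
    exact integral_eq_zero_of_hasDerivAt_of_integrable (fun t => hF t trivial) iF' iF

theorem hasDerivAt_cpow_mul {α : ℝ} {t : ℝ} (ht : 0 < t) :
    HasDerivAt (fun z : ℂ => z * z ^ (α : ℂ)) ((α + 1) * (t : ℂ) ^ (α : ℂ)) t := by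
  have hne : (t : ℂ) ≠ 0 := Complex.ofReal_ne_zero.2 ht.ne'
  refine ((hasDerivAt_id (t : ℂ)).mul ((hasDerivAt_id (t : ℂ)).cpow_const
    (c := (α : ℂ)) (Complex.ofReal_mem_slitPlane.2 ht))).congr_deriv ?_
  simp only [id, Complex.cpow_sub _ _ hne, Complex.cpow_one]
  field_simp
  ring

theorem norm_mul_cpow {α : ℝ} {t : ℝ} (ht : 0 < t) :
    ‖(t : ℂ) * (t : ℂ) ^ (α : ℂ)‖ = t ^ (α + 1) := by
  rw [norm_mul, Complex.norm_cpow_eq_rpow_re_of_pos ht, Complex.norm_real, Complex.ofReal_re,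
    Real.norm_of_nonneg ht.le, Real.rpow_add_one ht.ne', mul_comm]

open Filter Topology in
-- Moments are Gamma integrals. At the origin `F` is bounded by a polynomial times `t ^ (α + 1)
-- e^{-t}`, which tends to zero as `α + 1 > 0`; at infinity `F → 0` because `F` and `F'` are
-- integrable.
theorem isClassicalWeight_laguerre {α : ℝ} (hα : -1 < α) :
    IsClassicalWeight halfLine (laguerreWeight α) 0 1 0 (α + 1) (-1) := by
  refine .of_boundary rfl (fun n => ?_) (fun t ht => ?_) fun F F' hF iF iF' hb => ?_
  · have h := Complex.GammaIntegral_convergent (s := n + α + 1)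
      (by simp; linarith [(Nat.cast_nonneg n : (0 : ℝ) ≤ n)])
    refine h.congr_fun (fun t ht => ?_) measurableSet_Ioi
    have hne : (t : ℂ) ≠ 0 := Complex.ofReal_ne_zero.2 (ne_of_gt ht)
    simp only [laguerreWeight, add_sub_cancel_right, Complex.cpow_add _ _ hne,
      Complex.cpow_natCast]
    push_cast
    ring
  · have h := ((hasDerivAt_cpow_mul (α := α) ht).mul (hasDerivAt_id (t : ℂ)).neg.cexp).comp_ofReal
    refine h.congr_of_eventuallyEq ?_ |>.congr_deriv ?_
    · refine Eventually.of_forall fun t => ?_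
      simp [laguerreWeight, mul_assoc]
    · simp [laguerreWeight]; ring
  · change ∀ t ∈ Set.Ioi (0 : ℝ), _ at hF
    change IntegrableOn F (Set.Ioi (0 : ℝ)) at iF
    change IntegrableOn F' (Set.Ioi (0 : ℝ)) at iF'
    obtain ⟨p, hp⟩ := hb
    have h0 : Tendsto F (𝓝[>] 0) (𝓝 0) := by
      have hc : Continuous fun t : ℝ => ‖p.eval (t : ℂ)‖ * (t ^ (α + 1) * Real.exp (-t)) :=
        (p.continuous.comp Complex.continuous_ofReal).norm.mul
          ((Real.continuous_rpow_const (by linarith)).mul (by fun_prop))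
      have hc0 := (hc.tendsto 0).mono_left (nhdsWithin_le_nhds (s := Set.Ioi 0))
      rw [Real.zero_rpow (by linarith), zero_mul, mul_zero] at hc0
      refine squeeze_zero_norm' ?_ hc0
      filter_upwards [self_mem_nhdsWithin] with t ht
      refine (hp t ht).trans (le_of_eq ?_)
      rw [norm_mul, show (0 + 1 * (t : ℂ) + 0 * (t : ℂ) ^ 2) * laguerreWeight α t =
        (t : ℂ) * (t : ℂ) ^ (α : ℂ) * Complex.exp (-t) by rw [laguerreWeight]; ring, norm_mul,
        norm_mul_cpow ht, Complex.norm_exp]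
      simp
    have h1 := tendsto_zero_of_hasDerivAt_of_integrableOn_Ioi hF iF' iF
    have := integral_Ioi_deriv_mul_eq_sub (u := F) (v := fun _ => (1 : ℂ)) (v' := fun _ => 0)
      (a := 0) (a' := 0) (b' := 0) hF (fun t _ => hasDerivAt_const _ _)
      (iF'.congr (Eventually.of_forall fun t => by simp)) (h0.congr fun t => by simp)
      (h1.congr fun t => by simp)
    simp only [mul_one, mul_zero, add_zero, sub_zero] at this
    exact this

open Filter Topology in
-- Moments are Beta integrals, and `t ^ (α + 1) (1 - t) ^ (β + 1)` vanishes at both end points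
-- because the exponents are positive.
theorem isClassicalWeight_jacobi {α β : ℝ} (hα : -1 < α) (hβ : -1 < β) :
    IsClassicalWeight unitSegment (jacobiWeight α β) 0 1 (-1) (α + 1) (-(α + β + 2)) := by
  refine .of_boundary rfl (fun n => ?_) (fun t ht => ?_) fun F F' hF iF iF' hb => ?_
  · have h := Complex.betaIntegral_convergent (u := n + α + 1) (v := β + 1)
      (by simp; linarith [(Nat.cast_nonneg n : (0 : ℝ) ≤ n)]) (by simp; linarith)
    rw [intervalIntegrable_iff_integrableOn_Ioo_of_le zero_le_one] at h
    refine h.congr_fun (fun t ht => ?_) measurableSet_Ioo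
    have hne : (t : ℂ) ≠ 0 := Complex.ofReal_ne_zero.2 (ne_of_gt ht.1)
    simp only [jacobiWeight, add_sub_cancel_right, Complex.cpow_add _ _ hne,
      Complex.cpow_natCast]
    ring
  · have h1 := hasDerivAt_cpow_mul (α := α) ht.1
    have h2 := hasDerivAt_cpow_mul (α := β) (sub_pos.2 ht.2)
    push_cast at h2
    have h3 := (h1.mul (h2.comp (t : ℂ) ((hasDerivAt_id (t : ℂ)).const_sub 1))).comp_ofReal
    refine h3.congr_of_eventuallyEq ?_ |>.congr_deriv ?_
    · refine Eventually.of_forall fun t => ?_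
      simp [jacobiWeight]
      ring
    · simp [jacobiWeight]
      ring
  · change ∀ t ∈ Set.Ioo (0 : ℝ) 1, _ at hF
    change IntegrableOn F' (Set.Ioo (0 : ℝ) 1) at iF'
    obtain ⟨p, hp⟩ := hb
    have hc : Continuous fun t : ℝ => ‖p.eval (t : ℂ)‖ * (t ^ (α + 1) * (1 - t) ^ (β + 1)) :=
      (p.continuous.comp Complex.continuous_ofReal).norm.mul
        ((Real.continuous_rpow_const (by linarith)).mul
          ((Real.continuous_rpow_const (by linarith)).comp (continuous_const.sub continuous_id)))
    have hle : ∀ t ∈ Set.Ioo (0 : ℝ) 1,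
        ‖F t‖ ≤ ‖p.eval (t : ℂ)‖ * (t ^ (α + 1) * (1 - t) ^ (β + 1)) := fun t ht => by
      refine (hp t ht).trans (le_of_eq ?_)
      have h2 := norm_mul_cpow (α := β) (sub_pos.2 ht.2)
      push_cast at h2
      rw [norm_mul, show (0 + 1 * (t : ℂ) + -1 * (t : ℂ) ^ 2) * jacobiWeight α β t =
        ((t : ℂ) * (t : ℂ) ^ (α : ℂ)) * ((1 - (t : ℂ)) * (1 - (t : ℂ)) ^ (β : ℂ)) by
          rw [jacobiWeight]; ring, norm_mul ((t : ℂ) * _), norm_mul_cpow ht.1, h2]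
    have h0 : Tendsto F (𝓝[>] 0) (𝓝 0) := by
      have hc0 := (hc.tendsto 0).mono_left (nhdsWithin_le_nhds (s := Set.Ioi 0))
      rw [Real.zero_rpow (by linarith), zero_mul, mul_zero] at hc0
      refine squeeze_zero_norm' ?_ hc0
      filter_upwards [Ioo_mem_nhdsGT zero_lt_one] with t ht using hle t ht
    have h1 : Tendsto F (𝓝[<] 1) (𝓝 0) := by
      have hc0 := (hc.tendsto 1).mono_left (nhdsWithin_le_nhds (s := Set.Iio 1))
      rw [sub_self, Real.zero_rpow (by linarith), mul_zero, mul_zero] at hc0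
      refine squeeze_zero_norm' ?_ hc0
      filter_upwards [Ioo_mem_nhdsLT zero_lt_one] with t ht using hle t ht
    have := intervalIntegral.integral_eq_sub_of_hasDerivAt_of_tendsto zero_lt_one hF
      ((intervalIntegrable_iff_integrableOn_Ioo_of_le zero_le_one).2 iF') h0 h1
    rw [intervalIntegral.integral_of_le zero_le_one, integral_Ioc_eq_integral_Ioo, sub_zero] at this
    exact this

/-! ### The Berezanskii construction -/

section Berezanskii

theorem berezanskii_apply {R : Type*} [Ring R] [Module ℂ R] (a b : R) (i j : Fin 2) :
    berezanskii a b i j = (2⁻¹ : ℂ) • (a + (if i = j then b else -b)) := by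
  fin_cases i <;> fin_cases j <;> simp [berezanskii, sub_eq_add_neg]

/-- The matrix is `U diag(a, b) U` with the involution `U = [[1, 1], [1, -1]] / √2`, so the
construction is a homomorphism from pairs of scalars to commuting matrices. -/
theorem berezanskii_mul (a b c d : ℂ) :
    berezanskii a b * berezanskii c d = berezanskii (a * c) (b * d) := by
  ext i j
  rw [Matrix.mul_apply, Fin.sum_univ_two]
  fin_cases i <;> fin_cases j <;> simp [berezanskii_apply] <;> ring

theorem smul_berezanskii (r a b : ℂ) : r • berezanskii a b = berezanskii (r * a) (r * b) := by
  ext i j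
  fin_cases i <;> fin_cases j <;> simp [berezanskii_apply] <;> ring

theorem berezanskii_add (a b c d : ℂ) :
    berezanskii a b + berezanskii c d = berezanskii (a + c) (b + d) := by
  ext i j
  fin_cases i <;> fin_cases j <;> simp [berezanskii_apply] <;> ring

theorem berezanskii_one_one : berezanskii (1 : ℂ) 1 = 1 := by
  ext i j
  fin_cases i <;> fin_cases j <;> simp [berezanskii_apply] <;> norm_num

theorem berezanskii_zero_zero : berezanskii (0 : ℂ) 0 = 0 := by
  ext i j
  fin_cases i <;> fin_cases j <;> simp [berezanskii_apply]

theorem det_berezanskii (a b : ℂ) : (berezanskii a b).det = a * b := by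
  rw [Matrix.det_fin_two]
  simp [berezanskii_apply]
  ring

theorem berezanskii_inv {a b : ℂ} (ha : a ≠ 0) (hb : b ≠ 0) :
    (berezanskii a⁻¹ b⁻¹)⁻¹ = berezanskii a b := by
  refine Matrix.inv_eq_right_inv ?_
  rw [berezanskii_mul, inv_mul_cancel₀ ha, inv_mul_cancel₀ hb, berezanskii_one_one]

theorem evalAt_berezanskiiPoly (p₁ p₂ : ℕ → ℂ[X]) (n : ℕ) :
    evalAt (berezanskiiPoly p₁ p₂ n) = fun z => berezanskii ((p₁ n).eval z) ((p₂ n).eval z) := by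
  funext z
  ext i j
  rw [evalAt, berezanskiiPoly, matPolyEquiv_eval, berezanskii_apply, berezanskii_apply]
  split_ifs <;> simp [mul_add]

theorem isMonicSequence_berezanskiiPoly {p₁ p₂ : ℕ → ℂ[X]} (h₁ : ∀ n, (p₁ n).Monic)
    (d₁ : ∀ n, (p₁ n).natDegree = n) (h₂ : ∀ n, (p₂ n).Monic) (d₂ : ∀ n, (p₂ n).natDegree = n) :
    IsMonicSequence (berezanskiiPoly p₁ p₂) := by
  have hc : ∀ n k, (berezanskiiPoly p₁ p₂ n).coeff k
      = berezanskii ((p₁ n).coeff k) ((p₂ n).coeff k) := fun n k => by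
    ext i j
    rw [berezanskiiPoly, matPolyEquiv_coeff_apply, berezanskii_apply, berezanskii_apply]
    split_ifs <;> simp [mul_add]
  refine fun n => ⟨natDegree_le_iff_coeff_eq_zero.2 fun k hk => ?_, ?_⟩
  · rw [hc, coeff_eq_zero_of_natDegree_lt (by rw [d₁]; exact hk),
      coeff_eq_zero_of_natDegree_lt (by rw [d₂]; exact hk), berezanskii_zero_zero]
  · rw [hc, coeff_of_monic h₁ d₁, coeff_of_monic h₂ d₂, berezanskii_one_one]

theorem mderiv_berezanskii {f g : ℂ → ℂ} {z : ℂ} (hf : DifferentiableAt ℂ f z)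
    (hg : DifferentiableAt ℂ g z) :
    mderiv (fun w => berezanskii (f w) (g w)) z = berezanskii (deriv f z) (deriv g z) := by
  ext i j
  simp only [mderiv, Matrix.of_apply, berezanskii_apply, smul_eq_mul]
  split_ifs
  · rw [deriv_const_mul _ (hf.fun_add hg), deriv_fun_add hf hg]
  · rw [deriv_const_mul _ (hf.fun_add hg.fun_neg), deriv_fun_add hf hg.fun_neg, deriv.fun_neg]

theorem holomorphicOn_berezanskii {f g : ℂ → ℂ} {U : Set ℂ} (hf : DifferentiableOn ℂ f U)
    (hg : DifferentiableOn ℂ g U) : HolomorphicOn (fun w => berezanskii (f w) (g w)) U :=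
  fun i j => by
    simp only [berezanskii_apply]
    split_ifs
    · exact (hf.fun_add hg).fun_const_smul (2⁻¹ : ℂ)
    · exact (hf.fun_add hg.fun_neg).fun_const_smul (2⁻¹ : ℂ)

variable {γ : SmoothArc}

theorem matIntegral_berezanskii {f g : ℂ → ℂ} (hf : γ.IntegrableAlong f)
    (hg : γ.IntegrableAlong g) :
    γ.matIntegral (fun t => berezanskii (f t) (g t)) =
      berezanskii (γ.integral f) (γ.integral g) := by
  ext i j
  -- The signs `s = 1` and `s = -1` give the diagonal and the off-diagonal entries.
  have key : ∀ s : ℂ, γ.integral (fun t => (2⁻¹ : ℂ) * (f t + s * g t)) =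
      2⁻¹ * (γ.integral f + s * γ.integral g) := fun s => by
    rw [SmoothArc.integral_const_mul, SmoothArc.integral_add hf (hg.const_mul s),
      SmoothArc.integral_const_mul]
  simp only [SmoothArc.matIntegral, Matrix.of_apply, berezanskii_apply, smul_eq_mul]
  split_ifs
  · simpa using key 1
  · simpa using key (-1)

variable {w₁ w₂ : ℂ → ℂ} {a b c d₁ d₂ e : ℂ}

/-- For `k = n` the power `X ^ n` may be replaced by `p n`, since their difference has lower degree
and is orthogonal to `p n`. -/
theorem IsClassicalWeight.integral_pow_mul {w : ℂ → ℂ} {d : ℂ}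
    (h : IsClassicalWeight γ w a b c d e) {p : ℕ → ℂ[X]} (hp : IsMonicOrthogonal γ w p) {n k : ℕ}
    (hk : k ≤ n) : γ.integral (fun t => t ^ k * ((p n).eval t * w t)) =
      if n = k then γ.integral (fun t => (p n).eval t * w t * (p n).eval t) else 0 := by
  have hf : ∀ n m, h.functional (p n * p m)
      = γ.integral fun t => (p n).eval t * w t * (p m).eval t := fun n m => by
    rw [functional_apply]
    exact SmoothArc.integral_congr fun t _ => by rw [eval_mul]; ring
  have ho : ∀ n m, n ≠ m → h.functional (p n * p m) = 0 := fun n m hnm => by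
    rw [hf, hp.orthogonal n m hnm]
  have e1 : γ.integral (fun t => t ^ k * ((p n).eval t * w t)) = h.functional (p n * X ^ k) := by
    rw [functional_apply]
    exact SmoothArc.integral_congr fun t _ => by rw [eval_mul, eval_pow, eval_X]; ring
  rw [e1]
  split_ifs with hnk
  · subst hnk
    rw [← hf, ← sub_eq_zero, ← map_sub, ← mul_sub]
    refine orthogonal_lower h.functional hp.monic hp.natDegree_eq ho n le_rfl _ ?_
    have := degree_sub_C_mul_lt hp.monic hp.natDegree_eq (k := n) (q := X ^ n)
      (by rw [degree_X_pow]; exact_mod_cast Nat.lt_succ_self n)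
    simpa using this
  · refine orthogonal_lower h.functional hp.monic hp.natDegree_eq ho n le_rfl _ ?_
    rw [degree_X_pow]
    exact_mod_cast lt_of_le_of_ne hk (Ne.symm hnk)

variable {p₁ p₂ : ℕ → ℂ[X]}

/-- `C_n` is the Berezanskii matrix of the reciprocal squared norms. Polynomials and weight commute,
so the left and right conditions coincide. -/
theorem berezanskii_biorthogonal (h₁ : IsClassicalWeight γ w₁ a b c d₁ e)
    (h₂ : IsClassicalWeight γ w₂ a b c d₂ e) (hp₁ : IsMonicOrthogonal γ w₁ p₁)
    (hp₂ : IsMonicOrthogonal γ w₂ p₂) :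
    ∃ C, IsLeftOrthogonal γ (berezanskiiWeight w₁ w₂) (berezanskiiPoly p₁ p₂) C ∧
      IsRightOrthogonal γ (berezanskiiWeight w₁ w₂) (berezanskiiPoly p₁ p₂) C := by
  have hm := isMonicSequence_berezanskiiPoly hp₁.monic hp₁.natDegree_eq hp₂.monic hp₂.natDegree_eq
  have n₁ := hp₁.norm_ne_zero
  have n₂ := hp₂.norm_ne_zero
  have hdet : ∀ n, (berezanskii (γ.integral fun t => (p₁ n).eval t * w₁ t * (p₁ n).eval t)⁻¹
      (γ.integral fun t => (p₂ n).eval t * w₂ t * (p₂ n).eval t)⁻¹).det ≠ 0 := fun n => by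
    rw [det_berezanskii]
    exact mul_ne_zero (inv_ne_zero (n₁ n)) (inv_ne_zero (n₂ n))
  have hint : ∀ n k : ℕ, k ≤ n → γ.matIntegral (fun t =>
      berezanskii (t ^ k * ((p₁ n).eval t * w₁ t)) (t ^ k * ((p₂ n).eval t * w₂ t))) =
      if n = k then (berezanskii (γ.integral fun t => (p₁ n).eval t * w₁ t * (p₁ n).eval t)⁻¹
      (γ.integral fun t => (p₂ n).eval t * w₂ t * (p₂ n).eval t)⁻¹)⁻¹ else 0 := fun n k hk => by
    have i : ∀ {w : ℂ → ℂ} {d : ℂ} (_ : IsClassicalWeight γ w a b c d e) (p : ℂ[X]),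
        γ.IntegrableAlong fun t => t ^ k * (p.eval t * w t) := fun h p =>
      (h.integrable (X ^ k * p)).congr fun t _ => by
        rw [eval_mul, eval_pow, eval_X, mul_assoc]
    rw [matIntegral_berezanskii (i h₁ _) (i h₂ _), h₁.integral_pow_mul hp₁ hk,
      h₂.integral_pow_mul hp₂ hk, berezanskii_inv (n₁ n) (n₂ n)]
    split_ifs
    · rfl
    · exact berezanskii_zero_zero
  refine ⟨_, ⟨hm, hdet, fun n k hk => ?_⟩, ⟨hm, hdet, fun n k hk => ?_⟩⟩
  · rw [← hint n k hk, evalAt_berezanskiiPoly]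
    simp only [berezanskiiWeight, berezanskii_mul, smul_berezanskii]
  · rw [← hint n k hk, evalAt_berezanskiiPoly]
    simp only [berezanskiiWeight, berezanskii_mul, smul_berezanskii, mul_comm (w₁ _),
      mul_comm (w₂ _)]

/-- The equation holds in each component because the two weights share `a`, `b`, `c`, `e`, hence the
eigenvalue. -/
theorem berezanskii_polynomial_equation (h₁ : IsClassicalWeight γ w₁ a b c d₁ e)
    (h₂ : IsClassicalWeight γ w₂ a b c d₂ e) (hp₁ : IsMonicOrthogonal γ w₁ p₁)
    (hp₂ : IsMonicOrthogonal γ w₂ p₂) (n : ℕ) (z : ℂ) :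
    (a + b * z + c * z ^ 2) • mderiv (mderiv (evalAt (berezanskiiPoly p₁ p₂ n))) z
      + mderiv (evalAt (berezanskiiPoly p₁ p₂ n)) z * berezanskii (d₁ + e * z) (d₂ + e * z)
      = hypEigenvalue c e n • evalAt (berezanskiiPoly p₁ p₂ n) z := by
  have hd : ∀ p₁ p₂ : ℂ[X], mderiv (fun z => berezanskii (p₁.eval z) (p₂.eval z)) =
      fun z => berezanskii (p₁.derivative.eval z) (p₂.derivative.eval z) := fun p₁ p₂ => by
    funext z
    rw [mderiv_berezanskii p₁.differentiableAt p₂.differentiableAt, Polynomial.deriv,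
      Polynomial.deriv]
  rw [evalAt_berezanskiiPoly, hd, hd]
  simp only [smul_berezanskii, berezanskii_mul, berezanskii_add]
  rw [← h₁.polynomial_equation hp₁, ← h₂.polynomial_equation hp₂, mul_comm (d₁ + _),
    mul_comm (d₂ + _)]

theorem secondKindL_berezanskii (h₁ : IsClassicalWeight γ w₁ a b c d₁ e)
    (h₂ : IsClassicalWeight γ w₂ a b c d₂ e) (p₁ p₂ : ℕ → ℂ[X]) (n : ℕ) {z : ℂ}
    (hz : z ∈ γ.supportᶜ) :
    secondKindL γ (berezanskiiWeight w₁ w₂) (berezanskiiPoly p₁ p₂) n z =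
      berezanskii (secondKind γ w₁ (p₁ n) z) (secondKind γ w₂ (p₂ n) z) := by
  rw [secondKindL, evalAt_berezanskiiPoly, IsClassicalWeight.secondKind_eq,
    IsClassicalWeight.secondKind_eq, ← matIntegral_berezanskii ((h₁.integrable _).resolvent hz 1)
      ((h₂.integrable _).resolvent hz 1)]
  simp only [berezanskiiWeight, berezanskii_mul, smul_berezanskii, pow_one]

theorem berezanskii_secondKind_equation (h₁ : IsClassicalWeight γ w₁ a b c d₁ e)
    (h₂ : IsClassicalWeight γ w₂ a b c d₂ e) (hp₁ : IsMonicOrthogonal γ w₁ p₁)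
    (hp₂ : IsMonicOrthogonal γ w₂ p₂) (n : ℕ) :
    HolomorphicOn (secondKindL γ (berezanskiiWeight w₁ w₂) (berezanskiiPoly p₁ p₂) n) γ.supportᶜ ∧
    ∀ z ∈ γ.supportᶜ, (a + b * z + c * z ^ 2) • mderiv (mderiv
        (secondKindL γ (berezanskiiWeight w₁ w₂) (berezanskiiPoly p₁ p₂) n)) z
      + mderiv (secondKindL γ (berezanskiiWeight w₁ w₂) (berezanskiiPoly p₁ p₂) n) z *
        berezanskii (2 * (b + 2 * c * z) - (d₁ + e * z)) (2 * (b + 2 * c * z) - (d₂ + e * z))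
      + (2 * c - e) • secondKindL γ (berezanskiiWeight w₁ w₂) (berezanskiiPoly p₁ p₂) n z
      = hypEigenvalue c e n •
        secondKindL γ (berezanskiiWeight w₁ w₂) (berezanskiiPoly p₁ p₂) n z := by
  have hU := γ.isOpen_compl_support
  have hQ := fun z (hz : z ∈ γ.supportᶜ) => secondKindL_berezanskii h₁ h₂ p₁ p₂ n hz
  have q₁ := h₁.differentiableOn_secondKind (p₁ n)
  have q₂ := h₂.differentiableOn_secondKind (p₂ n)
  have hQ' : ∀ z ∈ γ.supportᶜ,
      mderiv (secondKindL γ (berezanskiiWeight w₁ w₂) (berezanskiiPoly p₁ p₂) n) z =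
      berezanskii (deriv (secondKind γ w₁ (p₁ n)) z) (deriv (secondKind γ w₂ (p₂ n)) z) :=
    fun z hz => by
      rw [mderiv_congr hU hQ hz, mderiv_berezanskii (q₁.differentiableAt (hU.mem_nhds hz))
        (q₂.differentiableAt (hU.mem_nhds hz))]
  refine ⟨(holomorphicOn_berezanskii q₁ q₂).congr hQ, fun z hz => ?_⟩
  rw [mderiv_congr hU hQ' hz, mderiv_berezanskii ((q₁.deriv hU).differentiableAt (hU.mem_nhds hz))
    ((q₂.deriv hU).differentiableAt (hU.mem_nhds hz)), hQ' z hz, hQ z hz]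
  simp only [smul_berezanskii, berezanskii_mul, berezanskii_add]
  rw [← h₁.secondKind_equation hp₁ n hz, ← h₂.secondKind_equation hp₂ n hz,
    mul_comm (2 * _ - (d₁ + _)), mul_comm (2 * _ - (d₂ + _))]

end Berezanskii

end RHMatrix

end

/-! ### Assembly: the general equations and the specialisations of the parameters -/

theorem mainTheorem3 :
    -- the second order relations for general weights
    (∀ (N : ℕ) (γ : RHMatrix.SmoothArc) (ω : ℂ → Matrix (Fin N) (Fin N) ℂ)
      (PL PR : ℕ → Polynomial (Matrix (Fin N) (Fin N) ℂ)) (C : ℕ → Matrix (Fin N) (Fin N) ℂ)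
      (φ : Polynomial ℂ) (hL hR : ℂ → Matrix (Fin N) (Fin N) ℂ) (D : Set ℂ)
      (ωL ωR : ℂ → Matrix (Fin N) (Fin N) ℂ),
      RHMatrix.IsRegular γ ω →
      RHMatrix.IsLeftOrthogonal γ ω PL C →
      RHMatrix.IsRightOrthogonal γ ω PR C →
      RHMatrix.PearsonFactorization φ hL hR D ω ωL ωR →
      ∀ n : ℕ,
        let YL := RHMatrix.YL γ ω PL C n
        let YR := RHMatrix.YR γ ω PR C n
        let QL := RHMatrix.secondKindL γ ω PL n
        let QR := RHMatrix.secondKindR γ ω PR n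
        let ML := RHMatrix.structL φ ωL ωR YL
        let MR := RHMatrix.structR φ ωL ωR YR
        -- the fundamental matrices are holomorphic off the curve, with determinant one
        RHMatrix.HolomorphicOn YL γ.supportᶜ ∧ RHMatrix.HolomorphicOn YR γ.supportᶜ ∧
        (∀ z ∈ γ.supportᶜ, (YL z).det = 1 ∧ (YR z).det = 1) ∧
        RHMatrix.HolomorphicOn ML (D \ γ.support) ∧ RHMatrix.HolomorphicOn MR (D \ γ.support) ∧
        ∀ z ∈ D \ γ.support, φ.eval z ≠ 0 →
          -- left equation
          (φ.eval z • RHMatrix.mderiv (RHMatrix.mderiv YL) z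
            + RHMatrix.mderiv YL z * Matrix.fromBlocks
                ((2 : ℂ) • hL z + φ.derivative.eval z • 1) 0
                0 (-((2 : ℂ) • hR z) + φ.derivative.eval z • 1)
            + YL z * Matrix.fromBlocks (RHMatrix.opN φ hL z) 0 0 (RHMatrix.opN φ (-hR) z)
            = RHMatrix.opN φ ML z * YL z) ∧
          -- right equation
          (φ.eval z • RHMatrix.mderiv (RHMatrix.mderiv YR) z
            + Matrix.fromBlocks
                ((2 : ℂ) • hR z + φ.derivative.eval z • 1) 0
                0 (-((2 : ℂ) • hL z) + φ.derivative.eval z • 1) * RHMatrix.mderiv YR z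
            + Matrix.fromBlocks (RHMatrix.opN φ hR z) 0 0 (RHMatrix.opN φ (-hL) z) * YR z
            = YR z * RHMatrix.opN φ MR z) ∧
          -- the resulting equations for polynomials and second kind functions
          (φ.eval z • RHMatrix.mderiv (RHMatrix.mderiv (RHMatrix.evalAt (PL n))) z
            + RHMatrix.mderiv (RHMatrix.evalAt (PL n)) z
                * ((2 : ℂ) • hL z + φ.derivative.eval z • 1)
            + RHMatrix.evalAt (PL n) z * RHMatrix.opN φ hL z
            = (RHMatrix.opN φ ML z).toBlocks₁₁ * RHMatrix.evalAt (PL n) z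
              - (RHMatrix.opN φ ML z).toBlocks₁₂ * RHMatrix.prevPL PL C n z) ∧
          (φ.eval z • RHMatrix.mderiv (RHMatrix.mderiv QL) z
            + RHMatrix.mderiv QL z * (-((2 : ℂ) • hR z) + φ.derivative.eval z • 1)
            + QL z * RHMatrix.opN φ (-hR) z
            = (RHMatrix.opN φ ML z).toBlocks₁₁ * QL z
              - (RHMatrix.opN φ ML z).toBlocks₁₂ * RHMatrix.prevQL γ ω PL C n z) ∧
          (φ.eval z • RHMatrix.mderiv (RHMatrix.mderiv (RHMatrix.evalAt (PR n))) z
            + ((2 : ℂ) • hR z + φ.derivative.eval z • 1)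
                * RHMatrix.mderiv (RHMatrix.evalAt (PR n)) z
            + RHMatrix.opN φ hR z * RHMatrix.evalAt (PR n) z
            = RHMatrix.evalAt (PR n) z * (RHMatrix.opN φ MR z).toBlocks₁₁
              - RHMatrix.prevPR PR C n z * (RHMatrix.opN φ MR z).toBlocks₂₁) ∧
          (φ.eval z • RHMatrix.mderiv (RHMatrix.mderiv QR) z
            + (-((2 : ℂ) • hL z) + φ.derivative.eval z • 1) * RHMatrix.mderiv QR z
            + RHMatrix.opN φ (-hL) z * QR z
            = QR z * (RHMatrix.opN φ MR z).toBlocks₁₁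
              - RHMatrix.prevQR γ ω PR C n z * (RHMatrix.opN φ MR z).toBlocks₂₁)) ∧
    -- Hermite polynomials
    (∀ H : ℕ → Polynomial ℂ,
      RHMatrix.IsMonicOrthogonal RHMatrix.realLine RHMatrix.hermiteWeight H →
      ∀ n : ℕ,
        let c : ℕ → ℂ := fun k => (k : ℂ) / 2
        let Q := RHMatrix.secondKind RHMatrix.realLine RHMatrix.hermiteWeight (H n)
        (Polynomial.X * H n = H (n + 1) + Polynomial.C (c n) * H (n - 1)) ∧
        (∀ z : ℂ, (H n).derivative.derivative.eval z - 2 * z * (H n).derivative.eval z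
          = -(4 * c n) * (H n).eval z) ∧
        DifferentiableOn ℂ Q RHMatrix.realLine.supportᶜ ∧
        ∀ z ∈ RHMatrix.realLine.supportᶜ,
          deriv (deriv Q) z + 2 * z * deriv Q z = -(4 * c n + 2) * Q z) ∧
    -- scalar Laguerre polynomials
    (∀ α : ℝ, -1 < α → ∀ L : ℕ → Polynomial ℂ,
      RHMatrix.IsMonicOrthogonal RHMatrix.halfLine (RHMatrix.laguerreWeight α) L →
      ∀ n : ℕ,
        let Q := RHMatrix.secondKind RHMatrix.halfLine (RHMatrix.laguerreWeight α) (L n)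
        (∀ z : ℂ, z * (L n).derivative.derivative.eval z - (z - α - 1) * (L n).derivative.eval z
          = -(n : ℂ) * (L n).eval z) ∧
        DifferentiableOn ℂ Q RHMatrix.halfLine.supportᶜ ∧
        ∀ z ∈ RHMatrix.halfLine.supportᶜ,
          z * deriv (deriv Q) z + (z - α + 1) * deriv Q z = -((n : ℂ) + 1) * Q z) ∧
    -- Berezanskii matrix polynomials of Laguerre type
    (∀ α β : ℝ, -1 < α → -1 < β → ∀ p₁ p₂ : ℕ → Polynomial ℂ,
      RHMatrix.IsMonicOrthogonal RHMatrix.halfLine (RHMatrix.laguerreWeight α) p₁ →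
      RHMatrix.IsMonicOrthogonal RHMatrix.halfLine (RHMatrix.laguerreWeight β) p₂ →
      let W := RHMatrix.berezanskiiWeight (RHMatrix.laguerreWeight α) (RHMatrix.laguerreWeight β)
      let P := RHMatrix.berezanskiiPoly p₁ p₂
      let Ψ₁ : ℂ → Matrix (Fin 2) (Fin 2) ℂ := fun z => (2⁻¹ : ℂ) •
        !![-α - β + 2 * (z - 1), β - α; β - α, -α - β + 2 * (z - 1)]
      let Ψ₂ : ℂ → Matrix (Fin 2) (Fin 2) ℂ := fun z => (2⁻¹ : ℂ) •
        !![-α - β + 2 * (z + 1), β - α; β - α, -α - β + 2 * (z + 1)]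
      (∃ C, RHMatrix.IsLeftOrthogonal RHMatrix.halfLine W P C ∧
        RHMatrix.IsRightOrthogonal RHMatrix.halfLine W P C) ∧
      ∀ n : ℕ,
        let Q := RHMatrix.secondKindL RHMatrix.halfLine W P n
        (∀ z : ℂ, z • RHMatrix.mderiv (RHMatrix.mderiv (RHMatrix.evalAt (P n))) z
            - RHMatrix.mderiv (RHMatrix.evalAt (P n)) z * Ψ₁ z
          = -(n : ℂ) • RHMatrix.evalAt (P n) z) ∧
        RHMatrix.HolomorphicOn Q RHMatrix.halfLine.supportᶜ ∧
        ∀ z ∈ RHMatrix.halfLine.supportᶜ,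
          z • RHMatrix.mderiv (RHMatrix.mderiv Q) z + RHMatrix.mderiv Q z * Ψ₂ z
            = -((n : ℂ) + 1) • Q z) ∧
    -- scalar Jacobi polynomials on the unit interval
    (∀ α β : ℝ, -1 < α → -1 < β → ∀ p : ℕ → Polynomial ℂ,
      RHMatrix.IsMonicOrthogonal RHMatrix.unitSegment (RHMatrix.jacobiWeight α β) p →
      ∀ n : ℕ,
        let Q := RHMatrix.secondKind RHMatrix.unitSegment (RHMatrix.jacobiWeight α β) (p n)
        (∀ z : ℂ, z * (1 - z) * (p n).derivative.derivative.eval z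
            + (1 + α - (α + β + 2) * z) * (p n).derivative.eval z
            + n * (α + β + n + 1) * (p n).eval z = 0) ∧
        DifferentiableOn ℂ Q RHMatrix.unitSegment.supportᶜ ∧
        ∀ z ∈ RHMatrix.unitSegment.supportᶜ,
          z * (1 - z) * deriv (deriv Q) z + (1 - α + (α + β - 2) * z) * deriv Q z
            + (n + 1) * (α + β + n) * Q z = 0) ∧
    -- Berezanskii matrix polynomials of Jacobi type
    (∀ α β : ℝ, -1 < α → -1 < β → ∀ p₁ p₂ : ℕ → Polynomial ℂ,
      RHMatrix.IsMonicOrthogonal RHMatrix.unitSegment (RHMatrix.jacobiWeight α β) p₁ →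
      RHMatrix.IsMonicOrthogonal RHMatrix.unitSegment (RHMatrix.jacobiWeight β α) p₂ →
      let W := RHMatrix.berezanskiiWeight (RHMatrix.jacobiWeight α β) (RHMatrix.jacobiWeight β α)
      let P := RHMatrix.berezanskiiPoly p₁ p₂
      let Ψ₁ : ℂ → Matrix (Fin 2) (Fin 2) ℂ := fun z => (2⁻¹ : ℂ) •
        !![(1 - 2 * z) * (α + β + 2), α - β; α - β, (1 - 2 * z) * (α + β + 2)]
      let Ψ₂ : ℂ → Matrix (Fin 2) (Fin 2) ℂ := fun z => (2⁻¹ : ℂ) •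
        !![(2 * z - 1) * (α + β - 2), β - α; β - α, (2 * z - 1) * (α + β - 2)]
      (∃ C, RHMatrix.IsLeftOrthogonal RHMatrix.unitSegment W P C ∧
        RHMatrix.IsRightOrthogonal RHMatrix.unitSegment W P C) ∧
      ∀ n : ℕ,
        let Q := RHMatrix.secondKindL RHMatrix.unitSegment W P n
        (∀ z : ℂ, (z * (1 - z)) • RHMatrix.mderiv (RHMatrix.mderiv (RHMatrix.evalAt (P n))) z
            + RHMatrix.mderiv (RHMatrix.evalAt (P n)) z * Ψ₁ z
            + (n * (α + β + n + 1) : ℂ) • RHMatrix.evalAt (P n) z = 0) ∧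
        RHMatrix.HolomorphicOn Q RHMatrix.unitSegment.supportᶜ ∧
        ∀ z ∈ RHMatrix.unitSegment.supportᶜ,
          (z * (1 - z)) • RHMatrix.mderiv (RHMatrix.mderiv Q) z + RHMatrix.mderiv Q z * Ψ₂ z
            + ((n + 1) * (α + β + n) : ℂ) • Q z = 0) := by
  refine ⟨RHMatrix.general_second_order, ?_, ?_, ?_, ?_, ?_⟩
  · intro H hH n c Q
    have hw := RHMatrix.isClassicalWeight_hermite
    refine ⟨RHMatrix.hermite_recurrence hH.monic hH.natDegree_eq (hw.hypOp_eq hH) n,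
      fun z => ?_, hw.differentiableOn_secondKind _, fun z hz => ?_⟩
    · have h := hw.polynomial_equation hH n z
      simp only [RHMatrix.hypEigenvalue] at h
      linear_combination h
    · have h := hw.secondKind_equation hH n hz
      simp only [RHMatrix.hypEigenvalue] at h
      linear_combination h
  · intro α hα L hL n Q
    have hw := RHMatrix.isClassicalWeight_laguerre hα
    refine ⟨fun z => ?_, hw.differentiableOn_secondKind _, fun z hz => ?_⟩
    · have h := hw.polynomial_equation hL n z
      simp only [RHMatrix.hypEigenvalue] at h
      linear_combination h
    · have h := hw.secondKind_equation hL n hz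
      simp only [RHMatrix.hypEigenvalue] at h
      linear_combination h
  · intro α β hα hβ p₁ p₂ hp₁ hp₂ W P Ψ₁ Ψ₂
    have h₁ := RHMatrix.isClassicalWeight_laguerre hα
    have h₂ := RHMatrix.isClassicalWeight_laguerre hβ
    refine ⟨RHMatrix.berezanskii_biorthogonal h₁ h₂ hp₁ hp₂, ?_⟩
    intro n Q
    obtain ⟨hol, hQ⟩ := RHMatrix.berezanskii_secondKind_equation h₁ h₂ hp₁ hp₂ n
    refine ⟨fun z => ?_, hol, fun z hz => ?_⟩
    · have h := RHMatrix.berezanskii_polynomial_equation h₁ h₂ hp₁ hp₂ n z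
      -- The Laguerre `Ψ₁` enters the statement with a minus sign, hence the sign here; its
      -- components are `α + 1 - z` and `β + 1 - z`.
      have e : Ψ₁ z = -RHMatrix.berezanskii (α + 1 + -1 * z) (β + 1 + -1 * z : ℂ) := by
        ext i j
        fin_cases i <;> fin_cases j <;> simp [Ψ₁, RHMatrix.berezanskii] <;> ring
      rw [e, mul_neg, sub_neg_eq_add]
      convert h using 3
      · ring
      · simp [RHMatrix.hypEigenvalue]
    · have h := hQ z hz
      have e : Ψ₂ z = RHMatrix.berezanskii (2 * (1 + 2 * 0 * z) - (α + 1 + -1 * z))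
          (2 * (1 + 2 * 0 * z) - (β + 1 + -1 * z) : ℂ) := by
        ext i j
        fin_cases i <;> fin_cases j <;> simp [Ψ₂, RHMatrix.berezanskii] <;> ring
      -- The zeroth order coefficient `2 c - e = 1` moves to the right and turns the eigenvalue `-n`
      -- into `-(n + 1)`.
      rw [← e, ← eq_sub_iff_add_eq, ← sub_smul] at h
      convert h using 3
      · ring
      · simp [RHMatrix.hypEigenvalue]
        ring
  · intro α β hα hβ p hp n Q
    have hw := RHMatrix.isClassicalWeight_jacobi hα hβ
    refine ⟨fun z => ?_, hw.differentiableOn_secondKind _, fun z hz => ?_⟩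
    · have h := hw.polynomial_equation hp n z
      simp only [RHMatrix.hypEigenvalue] at h
      linear_combination h
    · have h := hw.secondKind_equation hp n hz
      simp only [RHMatrix.hypEigenvalue] at h
      linear_combination h
  · intro α β hα hβ p₁ p₂ hp₁ hp₂ W P Ψ₁ Ψ₂
    have h₁ := RHMatrix.isClassicalWeight_jacobi hα hβ
    have h₂ := RHMatrix.isClassicalWeight_jacobi hβ hα
    -- Exchanging `α` and `β` leaves the coefficient `e = -(α + β + 2)` unchanged, so both weights
    -- fit the common parameters once the sum is written in the same order.
    rw [add_comm (β : ℂ) α] at h₂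
    refine ⟨RHMatrix.berezanskii_biorthogonal h₁ h₂ hp₁ hp₂, ?_⟩
    intro n Q
    obtain ⟨hol, hQ⟩ := RHMatrix.berezanskii_secondKind_equation h₁ h₂ hp₁ hp₂ n
    refine ⟨fun z => ?_, hol, fun z hz => ?_⟩
    · have h := RHMatrix.berezanskii_polynomial_equation h₁ h₂ hp₁ hp₂ n z
      have e : Ψ₁ z = RHMatrix.berezanskii (α + 1 + -(α + β + 2) * z)
          (β + 1 + -(α + β + 2) * z : ℂ) := by
        ext i j
        fin_cases i <;> fin_cases j <;> simp [Ψ₁, RHMatrix.berezanskii] <;> ring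
      rw [← e, ← sub_eq_zero, sub_eq_add_neg, ← neg_smul] at h
      convert h using 4
      · ring
      · simp [RHMatrix.hypEigenvalue]
        ring
    · have h := hQ z hz
      have e : Ψ₂ z = RHMatrix.berezanskii (2 * (1 + 2 * -1 * z) - (α + 1 + -(α + β + 2) * z))
          (2 * (1 + 2 * -1 * z) - (β + 1 + -(α + β + 2) * z) : ℂ) := by
        ext i j
        fin_cases i <;> fin_cases j <;> simp [Ψ₂, RHMatrix.berezanskii] <;> ring
      rw [← e, ← eq_sub_iff_add_eq, ← sub_smul, ← sub_eq_zero, sub_eq_add_neg, ← neg_smul] at h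
      convert h using 4
      · ring
      · simp [RHMatrix.hypEigenvalue]
        ring
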